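/- Let $\epsilon_1,\epsilon_2,\epsilon_3\in\{1,-1\}$, let $E^3$ be $\mathbb R^3$ with the product $\langle x,y\rangle=\epsilon_1x_1y_1+\epsilon_2x_2y_2+\epsilon_3x_3y_3$, and put $\eta_1=\epsilon_3\epsilon_1$, $\eta_2=\epsilon_3\epsilon_2$. Let $U\subseteq\mathbb R^2$ be a non-empty connected open set and $\lambda_1,\lambda_2:U\to\mathbb R$. An $\epsilon$-isothermic Dupin surface with two distinct principal curvatures $-\lambda_1,-\lambda_2$ is a smooth immersion $X:U\to E^3$ with a smooth unit normal field $N$, $\langle N,N\rangle=\epsilon_3$, such that $N_{,i}=\lambda_iX_{,i}$ and $\lambda_{i,i}=0$ for $i=1,2$, $\lambda_1\neq\lambda_2$ at each point, and the first fundamental form is $I=(\lambda_2-\lambda_1)^{-2}(\epsilon_1du_1^2+\epsilon_2du_2^2)$ (the subscript $,i$ denotes the derivative with respect to $u_i$). If $X:U\to E^3$ is an $\epsilon$-isothermic Dupin surface with two distinct principal curvatures $-\lambda_1$ and $-\lambda_2$, then (i) $\lambda_1$ and $\lambda_2$ are constant and $\lambda_1\lambda_2=0$, or (ii) one of the following holds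 on $U$: 1. there are real constants $b_1,c_1$ with $b_1\ne0$, $1+b_1\neq0$ and complex constants $A_1,\dots,A_4$ with $$\lambda_2=-\frac{\eta_1c_1}{b_1}+A_1e^{\sqrt{b_1\eta_1}u_1}+A_2e^{-\sqrt{b_1\eta_1}u_1},\qquad \lambda_1=-\frac{\eta_1c_1}{1+b_1}+A_3e^{\sqrt{-\eta_2(1+b_1)}u_2}+A_4e^{-\sqrt{-\eta_2(1+b_1)}u_2},$$ $$c_1^2-4b_1(1+b_1)\bigl(b_1A_1A_2-(1+b_1)A_3A_4\bigr)=0;$$ 2. there are real constants $c_1,A_5,A_6$ and complex constants $A_7,A_8$ with $$\lambda_2=\frac{c_1}{2}u_1^2+A_5u_1+A_6,\qquad \lambda_1=-\eta_1c_1+A_7\cos(\sqrt{\eta_2}u_2)+A_8\sin(\sqrt{\eta_2}u_2),$$ $$\eta_1A_5^2-c_1^2-2\eta_1c_1A_6+A_7^2+A_8^2=0;$$ 3. there are real constants $b_2,c_2$ with $b_2\neq0$, $1+b_2\ne0$ and complex constants $B_1,\dots,B_4$ with $$\lambda_2=-\frac{\eta_2c_2}{1+b_2}+B_1e^{\sqrt{-\eta_1(1+b_2)}u_1}+B_2e^{-\sqrt{-\eta_1(1+b_2)}u_1},\qquad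 \lambda_1=-\frac{\eta_2c_2}{b_2}+B_3e^{\sqrt{b_2\eta_2}u_2}+B_4e^{-\sqrt{b_2\eta_2}u_2},$$ $$c_2^2+4b_2(1+b_2)\bigl((1+b_2)B_1B_2-b_2B_3B_4\bigr)=0;$$ 4. there are real constants $c_2,B_7,B_8$ and complex constants $B_5,B_6$ with $$\lambda_2=-\eta_2c_2+B_5\cos(\sqrt{\eta_1}u_1)+B_6\sin(\sqrt{\eta_1}u_1),\qquad \lambda_1=\frac{c_2}{2}u_2^2+B_7u_2+B_8,$$ $$\eta_2B_7^2-c_2^2-2\eta_2c_2B_8+B_5^2+B_6^2=0.$$ Here $\sqrt{x}=i\sqrt{-x}$ for $x<0$. Conversely, if real functions $\lambda_1,\lambda_2:U\to\mathbb R$, distinct at each point, satisfy (i) or (ii), then there is an $\epsilon$-isothermic Dupin surface $X:U\to E^3$ whose principal curvatures are $-\lambda_1$ and $-\lambda_2$. -/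

import Mathlib

open scoped ContDiff

noncomputable section

/-- The underlying vector space of the pseudo-Euclidean 3-space. -/
abbrev E3 : Type := Fin 3 → ℝ

/-- The pseudo-Euclidean product `ε₁ x₁ y₁ + ε₂ x₂ y₂ + ε₃ x₃ y₃` (indices of `Fin 3` start at 0). -/
def pinner (ε : Fin 3 → ℝ) (x y : E3) : ℝ :=
  ε 0 * x 0 * y 0 + ε 1 * x 1 * y 1 + ε 2 * x 2 * y 2

/-- The partial derivative with respect to `u₁`. -/
def partial₁ (f : ℝ × ℝ → E3) (p : ℝ × ℝ) : E3 :=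
  deriv (fun t : ℝ => f (t, p.2)) p.1

/-- The partial derivative with respect to `u₂`. -/
def partial₂ (f : ℝ × ℝ → E3) (p : ℝ × ℝ) : E3 :=
  deriv (fun t : ℝ => f (p.1, t)) p.2

/-- `X` is a smooth immersion of the open set `U` into the pseudo-Euclidean space and `N` is a
smooth unit normal vector field of `X`, with `⟨N, N⟩ = ε₃`. -/
structure IsSurfaceWithNormal (ε : Fin 3 → ℝ) (U : Set (ℝ × ℝ)) (X N : ℝ × ℝ → E3) : Prop where
  smooth : ContDiffOn ℝ ∞ X U
  smooth_normal : ContDiffOn ℝ ∞ N U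
  immersion : ∀ p ∈ U, LinearIndependent ℝ ![partial₁ X p, partial₂ X p]
  normal₁ : ∀ p ∈ U, pinner ε (N p) (partial₁ X p) = 0
  normal₂ : ∀ p ∈ U, pinner ε (N p) (partial₂ X p) = 0
  unit : ∀ p ∈ U, pinner ε (N p) (N p) = ε 2

/-- `X` is parametrized by lines of curvature: the coordinate directions are orthogonal and they are
principal directions, `N,ᵢ = lamᵢ X,ᵢ`. The principal curvatures (the eigenvalues of the shape
operator `-dN`) are thus `-lam₁` and `-lam₂`. -/
structure IsCurvatureLineParam (ε : Fin 3 → ℝ) (U : Set (ℝ × ℝ)) (X N : ℝ × ℝ → E3)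
    (lam₁ lam₂ : ℝ × ℝ → ℝ) : Prop extends IsSurfaceWithNormal ε U X N where
  orthogonal : ∀ p ∈ U, pinner ε (partial₁ X p) (partial₂ X p) = 0
  rodrigues₁ : ∀ p ∈ U, partial₁ N p = lam₁ p • partial₁ X p
  rodrigues₂ : ∀ p ∈ U, partial₂ N p = lam₂ p • partial₂ X p

/-- A Dupin surface parametrized by lines of curvature, with two distinct principal curvatures
`-lam₁`, `-lam₂`: each of them is constant along its lines of curvature, `lamᵢ,ᵢ = 0`. -/
structure IsDupin (ε : Fin 3 → ℝ) (U : Set (ℝ × ℝ)) (X N : ℝ × ℝ → E3)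
    (lam₁ lam₂ : ℝ × ℝ → ℝ) : Prop extends IsCurvatureLineParam ε U X N lam₁ lam₂ where
  distinct : ∀ p ∈ U, lam₁ p ≠ lam₂ p
  dupin₁ : ∀ p ∈ U, HasDerivAt (fun t : ℝ => lam₁ (t, p.2)) 0 p.1
  dupin₂ : ∀ p ∈ U, HasDerivAt (fun t : ℝ => lam₂ (p.1, t)) 0 p.2

/-- The first fundamental form of `X` on `U` is `ρ (ε₁ du₁² + ε₂ du₂²)`. -/
def FirstFormEq (ε : Fin 3 → ℝ) (U : Set (ℝ × ℝ)) (X : ℝ × ℝ → E3) (ρ : ℝ × ℝ → ℝ) : Prop :=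
  ∀ p ∈ U, pinner ε (partial₁ X p) (partial₁ X p) = ρ p * ε 0 ∧
    pinner ε (partial₁ X p) (partial₂ X p) = 0 ∧
    pinner ε (partial₂ X p) (partial₂ X p) = ρ p * ε 1

/-- An ε-isothermic Dupin surface with two distinct principal curvatures `-lam₁`, `-lam₂`, in
isothermic curvature-line parameters normalized so that the first fundamental form is
`(lam₂ - lam₁)⁻² (ε₁ du₁² + ε₂ du₂²)`. -/
structure IsIsothermicDupin (ε : Fin 3 → ℝ) (U : Set (ℝ × ℝ)) (X N : ℝ × ℝ → E3)
    (lam₁ lam₂ : ℝ × ℝ → ℝ) : Prop extends IsDupin ε U X N lam₁ lam₂ where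
  isothermic : FirstFormEq ε U X (fun p => 1 / (lam₂ p - lam₁ p) ^ 2)

/-- Both functions are constant on `U`, with product zero. -/
def ConstantCase (U : Set (ℝ × ℝ)) (lam₁ lam₂ : ℝ × ℝ → ℝ) : Prop :=
  ∃ k₁ k₂ : ℝ, k₁ * k₂ = 0 ∧ ∀ p ∈ U, lam₁ p = k₁ ∧ lam₂ p = k₂

/-- Case `b₁ ≠ 0`, `1 + b₁ ≠ 0`. The coefficients are complex, the functions are real. -/
def CaseOne (η₁ η₂ : ℝ) (U : Set (ℝ × ℝ)) (lam₁ lam₂ : ℝ × ℝ → ℝ) : Prop :=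
  ∃ (b₁ c₁ : ℝ) (A₁ A₂ A₃ A₄ : ℂ), b₁ ≠ 0 ∧ 1 + b₁ ≠ 0 ∧
    (∀ p ∈ U,
      (lam₂ p : ℂ) = -(η₁ * c₁) / b₁ + A₁ * Complex.exp (Complex.sqrt (b₁ * η₁) * p.1)
        + A₂ * Complex.exp (-Complex.sqrt (b₁ * η₁) * p.1) ∧
      (lam₁ p : ℂ) = -(η₁ * c₁) / (1 + b₁) + A₃ * Complex.exp (Complex.sqrt (-η₂ * (1 + b₁)) * p.2)
        + A₄ * Complex.exp (-Complex.sqrt (-η₂ * (1 + b₁)) * p.2)) ∧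
    (c₁ : ℂ) ^ 2 - 4 * b₁ * (1 + b₁) * (b₁ * A₁ * A₂ - (1 + b₁) * A₃ * A₄) = 0

/-- Case `b₁ = 0`. -/
def CaseTwo (η₁ η₂ : ℝ) (U : Set (ℝ × ℝ)) (lam₁ lam₂ : ℝ × ℝ → ℝ) : Prop :=
  ∃ (c₁ A₅ A₆ : ℝ) (A₇ A₈ : ℂ),
    (∀ p ∈ U,
      lam₂ p = c₁ / 2 * p.1 ^ 2 + A₅ * p.1 + A₆ ∧
      (lam₁ p : ℂ) = -(η₁ * c₁) + A₇ * Complex.cos (Complex.sqrt η₂ * p.2)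
        + A₈ * Complex.sin (Complex.sqrt η₂ * p.2)) ∧
    (η₁ : ℂ) * A₅ ^ 2 - c₁ ^ 2 - 2 * η₁ * c₁ * A₆ + A₇ ^ 2 + A₈ ^ 2 = 0

/-- Case `b₂ ≠ 0`, `1 + b₂ ≠ 0`. The coefficients are complex, the functions are real. -/
def CaseThree (η₁ η₂ : ℝ) (U : Set (ℝ × ℝ)) (lam₁ lam₂ : ℝ × ℝ → ℝ) : Prop :=
  ∃ (b₂ c₂ : ℝ) (B₁ B₂ B₃ B₄ : ℂ), b₂ ≠ 0 ∧ 1 + b₂ ≠ 0 ∧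
    (∀ p ∈ U,
      (lam₂ p : ℂ) = -(η₂ * c₂) / (1 + b₂) + B₁ * Complex.exp (Complex.sqrt (-η₁ * (1 + b₂)) * p.1)
        + B₂ * Complex.exp (-Complex.sqrt (-η₁ * (1 + b₂)) * p.1) ∧
      (lam₁ p : ℂ) = -(η₂ * c₂) / b₂ + B₃ * Complex.exp (Complex.sqrt (b₂ * η₂) * p.2)
        + B₄ * Complex.exp (-Complex.sqrt (b₂ * η₂) * p.2)) ∧
    (c₂ : ℂ) ^ 2 + 4 * b₂ * (1 + b₂) * ((1 + b₂) * B₁ * B₂ - b₂ * B₃ * B₄) = 0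

/-- Case `b₂ = 0`. -/
def CaseFour (η₁ η₂ : ℝ) (U : Set (ℝ × ℝ)) (lam₁ lam₂ : ℝ × ℝ → ℝ) : Prop :=
  ∃ (c₂ B₇ B₈ : ℝ) (B₅ B₆ : ℂ),
    (∀ p ∈ U,
      (lam₂ p : ℂ) = -(η₂ * c₂) + B₅ * Complex.cos (Complex.sqrt η₁ * p.1)
        + B₆ * Complex.sin (Complex.sqrt η₁ * p.1) ∧
      lam₁ p = c₂ / 2 * p.2 ^ 2 + B₇ * p.2 + B₈) ∧
    (η₂ : ℂ) * B₇ ^ 2 - c₂ ^ 2 - 2 * η₂ * c₂ * B₈ + B₅ ^ 2 + B₆ ^ 2 = 0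

/-- The explicit list of pairs of functions. -/
def ExplicitForm (η₁ η₂ : ℝ) (U : Set (ℝ × ℝ)) (lam₁ lam₂ : ℝ × ℝ → ℝ) : Prop :=
  CaseOne η₁ η₂ U lam₁ lam₂ ∨ CaseTwo η₁ η₂ U lam₁ lam₂ ∨
    CaseThree η₁ η₂ U lam₁ lam₂ ∨ CaseFour η₁ η₂ U lam₁ lam₂

end

/-!
Write `l₁`, `l₂` for the two functions, `φ = l₂ - l₁`, `η₁ = ε₃ ε₁`, `η₂ = ε₃ ε₂`. Both directions pass
through a linear system with constants `b`, `C`,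

`η₁ l₂'' = b l₂ + C`, `η₂ l₁'' = -(1 + b) l₁ - C`,

where `l₂` depends locally only on `u₁` and `l₁` only on `u₂`, together with the Gauss equation

`φ (η₁ l₂'' - η₂ l₁'') - η₁ l₂'² - η₂ l₁'² - l₁ l₂ = 0`

(`IsDupinSolution`). The Codazzi equations of the surface hold automatically. Differentiating the
Gauss equation of a surface (`IsIsothermicDupin.gauss`) shows that
`b = (η₁ l₂'' + η₂ l₁'' + l₁) / φ` has zero derivatives, and then so has `C = η₁ l₂'' - b l₂`;
as `U` is connected these are constants (`IsIsothermicDupin.exists_isDupinSolution`). No case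
distinction according to the zeros of `l₁'` and `l₂'` is needed.

Solving the linear system, by constants that are found as functions on `U` with zero derivatives,
gives the explicit lists: `b = 0` and `b = -1` are the cases with a quadratic polynomial, all other
`b` are exponential. The Gauss equation, which is a first integral, becomes the relation between
the coefficients (`IsDupinSolution.explicitForm`). Conversely, real parts of the complex expressions
solve the linear system (`exists_isDupinSolution`).

For the existence of the surface, `U` need not be simply connected, and a surface given by
integrating its frame equations could have monodromy. It is written down explicitly instead: in a
Dupin surface the curvature spheres `K = l₂ X - N` and `L = l₁ X - N` are functions of `u₁` and of `u₂`
alone, they satisfy linear equations with constant coefficients like those of `l₂` and `l₁`, and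
`X = (K - L) / φ`, `N = l₁ X - L`. Solving these equations on all of `ℝ` with the initial values
dictated by an adapted frame at one point defines `K` and `L`
(`IsDupinSolution.exists_isIsothermicDupin`). That they come from a surface amounts to a few
identities between scalar products (`isIsothermicDupin_of_curvature_spheres`), which follow from the
Gauss equation at that one point (`gauss_cross`).
-/

open Filter Topology

/-! ### Partial derivatives along coordinate lines -/

/-- `f` has the partial derivatives `g` (in the first variable) and `h` (in the second variable) at
each point of `U`. Only derivatives along the coordinate lines are involved. -/
def HasPartials {F : Type*} [NormedAddCommGroup F] [NormedSpace ℝ F] (U : Set (ℝ × ℝ))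
    (f g h : ℝ × ℝ → F) : Prop :=
  ∀ p ∈ U, HasDerivAt (fun t => f (t, p.2)) (g p) p.1 ∧ HasDerivAt (fun t => f (p.1, t)) (h p) p.2

namespace HasPartials

section Module
variable {F : Type*} [NormedAddCommGroup F] [NormedSpace ℝ F] {U : Set (ℝ × ℝ)}
  {f g h f' g' h' : ℝ × ℝ → F}

theorem const (c : F) : HasPartials U (fun _ => c) (fun _ => 0) (fun _ => 0) :=
  fun _ _ => ⟨hasDerivAt_const _ _, hasDerivAt_const _ _⟩

theorem add (H : HasPartials U f g h) (H' : HasPartials U f' g' h') :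
    HasPartials U (fun p => f p + f' p) (fun p => g p + g' p) (fun p => h p + h' p) :=
  fun p hp => ⟨(H p hp).1.add (H' p hp).1, (H p hp).2.add (H' p hp).2⟩

theorem sub (H : HasPartials U f g h) (H' : HasPartials U f' g' h') :
    HasPartials U (fun p => f p - f' p) (fun p => g p - g' p) (fun p => h p - h' p) :=
  fun p hp => ⟨(H p hp).1.sub (H' p hp).1, (H p hp).2.sub (H' p hp).2⟩

theorem of_fst {φ φ' : ℝ → F} (H : ∀ t, HasDerivAt φ (φ' t) t) :
    HasPartials U (fun p => φ p.1) (fun p => φ' p.1) (fun _ => 0) :=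
  fun p _ => ⟨H p.1, hasDerivAt_const p.2 (φ p.1)⟩

theorem swap (H : HasPartials U f g h) :
    HasPartials (Prod.swap ⁻¹' U) (f ∘ Prod.swap) (h ∘ Prod.swap) (g ∘ Prod.swap) :=
  fun p hp => ⟨(H p.swap hp).2, (H p.swap hp).1⟩

theorem congr (H : HasPartials U f g h) (hg : ∀ p ∈ U, g p = g' p) (hh : ∀ p ∈ U, h p = h' p) :
    HasPartials U f g' h' :=
  fun p hp => ⟨hg p hp ▸ (H p hp).1, hh p hp ▸ (H p hp).2⟩

theorem comp_clm {G : Type*} [NormedAddCommGroup G] [NormedSpace ℝ G] (H : HasPartials U f g h)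
    (T : F →L[ℝ] G) : HasPartials U (fun p => T (f p)) (fun p => T (g p)) (fun p => T (h p)) :=
  fun p hp => ⟨T.hasFDerivAt.comp_hasDerivAt _ (H p hp).1, T.hasFDerivAt.comp_hasDerivAt _ (H p hp).2⟩

end Module

section Algebra
variable {F : Type*} [NormedRing F] [NormedAlgebra ℝ F] {U : Set (ℝ × ℝ)}
  {f g h f' g' h' : ℝ × ℝ → F}

theorem mul (H : HasPartials U f g h) (H' : HasPartials U f' g' h') :
    HasPartials U (fun p => f p * f' p) (fun p => g p * f' p + f p * g' p)
      (fun p => h p * f' p + f p * h' p) :=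
  fun p hp => ⟨(H p hp).1.mul (H' p hp).1, (H p hp).2.mul (H' p hp).2⟩

theorem const_mul (c : F) (H : HasPartials U f g h) :
    HasPartials U (fun p => c * f p) (fun p => c * g p) (fun p => c * h p) :=
  fun p hp => ⟨(H p hp).1.const_mul c, (H p hp).2.const_mul c⟩

end Algebra

theorem ofReal {U : Set (ℝ × ℝ)} {f g h : ℝ × ℝ → ℝ} (H : HasPartials U f g h) :
    HasPartials U (fun p => (f p : ℂ)) (fun p => (g p : ℂ)) (fun p => (h p : ℂ)) :=
  H.comp_clm Complex.ofRealCLM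

end HasPartials

/-! ### Functions with vanishing partial derivatives on connected open sets -/

theorem eventually_mem_fst {U : Set (ℝ × ℝ)} (hU : IsOpen U) {p : ℝ × ℝ} (hp : p ∈ U) :
    ∀ᶠ t in 𝓝 p.1, (t, p.2) ∈ U :=
  (by fun_prop : Continuous fun t : ℝ => (t, p.2)).continuousAt.eventually_mem (hU.mem_nhds hp)

theorem eventually_mem_snd {U : Set (ℝ × ℝ)} (hU : IsOpen U) {p : ℝ × ℝ} (hp : p ∈ U) :
    ∀ᶠ t in 𝓝 p.2, (p.1, t) ∈ U :=
  (by fun_prop : Continuous fun t : ℝ => (p.1, t)).continuousAt.eventually_mem (hU.mem_nhds hp)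

section Constancy
variable {F : Type*} [NormedAddCommGroup F] [NormedSpace ℝ F] {U : Set (ℝ × ℝ)}
  {f g h : ℝ × ℝ → F}

theorem HasPartials.congr_fun {f' : ℝ × ℝ → F} (hU : IsOpen U) (H : HasPartials U f g h)
    (hf : ∀ p ∈ U, f' p = f p) : HasPartials U f' g h := fun p hp =>
  ⟨(H p hp).1.congr_of_eventuallyEq ((eventually_mem_fst hU hp).mono fun _ ht => hf _ ht),
   (H p hp).2.congr_of_eventuallyEq ((eventually_mem_snd hU hp).mono fun _ ht => hf _ ht)⟩

theorem eq_on_ball_of_hasDerivAt_zero {φ : ℝ → F} {a r : ℝ}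
    (H : ∀ t ∈ Metric.ball a r, HasDerivAt φ 0 t) {s : ℝ} (hs : s ∈ Metric.ball a r) : φ s = φ a := by
  have ha : a ∈ Metric.ball a r := Metric.mem_ball_self (dist_nonneg.trans_lt hs)
  exact Metric.isOpen_ball.is_const_of_deriv_eq_zero (convex_ball a r).isPreconnected
    (fun t ht => (H t ht).differentiableAt.differentiableWithinAt)
    (fun t ht => (H t ht).deriv) hs ha

/-- No joint differentiability is needed: in a square around a point of `U` each point is reached
along a horizontal and a vertical segment. -/
theorem HasPartials.exists_eq_const (hU : IsOpen U) (hUc : IsConnected U)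
    (H : HasPartials U f (fun _ => 0) (fun _ => 0)) : ∃ c, ∀ p ∈ U, f p = c := by
  obtain ⟨p₀, hp₀⟩ := hUc.nonempty
  refine ⟨f p₀, fun p hp => ?_⟩
  refine hUc.isPreconnected.induction₂ (fun x y => f y = f x) (fun x hx => ?_)
    (fun x y z _ _ _ h₁ h₂ => h₂.trans h₁) (fun x y _ _ h₁ => h₁.symm) hp₀ hp
  obtain ⟨r, hr, hrU⟩ := Metric.isOpen_iff.1 hU x hx
  refine mem_nhdsWithin_of_mem_nhds ?_
  filter_upwards [Metric.ball_mem_nhds x hr] with y hy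
  rw [← Prod.mk.eta (p := x), ← ball_prod_same] at hrU
  have hy' : y.1 ∈ Metric.ball x.1 r ∧ y.2 ∈ Metric.ball x.2 r := by
    rw [← Prod.mk.eta (p := x), ← ball_prod_same] at hy
    exact hy
  have h₁ : f (y.1, y.2) = f (y.1, x.2) :=
    eq_on_ball_of_hasDerivAt_zero (φ := fun t => f (y.1, t))
      (fun t ht => (H (y.1, t) (hrU ⟨hy'.1, ht⟩)).2) hy'.2
  have h₂ : f (y.1, x.2) = f (x.1, x.2) :=
    eq_on_ball_of_hasDerivAt_zero (φ := fun t => f (t, x.2))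
      (fun t ht => (H (t, x.2) (hrU ⟨ht, Metric.mem_ball_self hr⟩)).1) hy'.1
  exact h₁.trans h₂

end Constancy

/-! ### The linear system behind the explicit functions -/

/-- The pair `l₁`, `l₂` satisfies the linear equations `η₁ l₂'' = b l₂ + C` and
`η₂ l₁'' = -(1 + b) l₁ - C`, where `l₂` depends locally only on `u₁` and `l₁` only on `u₂`, and the
Gauss equation of the surface. The functions `m₁`, `m₂` are the derivatives of `l₁`, `l₂`. -/
structure IsDupinSolution (η₁ η₂ b C : ℝ) (U : Set (ℝ × ℝ)) (l₁ l₂ m₁ m₂ : ℝ × ℝ → ℝ) : Prop where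
  partials_l₂ : HasPartials U l₂ m₂ (fun _ => 0)
  partials_m₂ : HasPartials U m₂ (fun p => η₁ * b * l₂ p + η₁ * C) (fun _ => 0)
  partials_l₁ : HasPartials U l₁ (fun _ => 0) m₁
  partials_m₁ : HasPartials U m₁ (fun _ => 0) (fun p => -η₂ * (1 + b) * l₁ p + -η₂ * C)
  gauss : ∀ p ∈ U, (l₂ p - l₁ p) * (b * l₂ p + (1 + b) * l₁ p + 2 * C) - η₁ * m₂ p ^ 2
    - η₂ * m₁ p ^ 2 - l₁ p * l₂ p = 0

/-! ### From the linear system to the explicit functions -/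

section Explicit
variable {U : Set (ℝ × ℝ)} {l m : ℝ × ℝ → ℝ} {β γ : ℝ} {μ : ℂ}

theorem hasDerivAt_cexp_mul (μ : ℂ) (t : ℝ) :
    HasDerivAt (fun t : ℝ => Complex.exp (μ * t)) (μ * Complex.exp (μ * t)) t := by
  have h : HasDerivAt (fun z : ℂ => Complex.exp (μ * z)) (μ * Complex.exp (μ * t)) (t : ℂ) := by
    have := ((hasDerivAt_id (t : ℂ)).const_mul μ).cexp
    simpa [mul_comm] using this
  exact h.comp_ofReal

/-- Solutions of `l'' = β l + γ` with `β = μ² ≠ 0`. The coefficients are found by variation of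
constants: they are the values of `(l + γ / β ± l' / μ) / 2 * exp (∓ μ u₁)`. -/
theorem exists_exp_coeffs (hU : IsOpen U) (hUc : IsConnected U)
    (hl : HasPartials U l m (fun _ => 0))
    (hm : HasPartials U m (fun p => β * l p + γ) (fun _ => 0)) (hβ : β ≠ 0) (hμ : μ ^ 2 = β) :
    ∃ A B : ℂ, ∀ p ∈ U,
      (l p : ℂ) = -γ / β + A * Complex.exp (μ * p.1) + B * Complex.exp (-μ * p.1) ∧
      (m p : ℂ) = μ * (A * Complex.exp (μ * p.1) - B * Complex.exp (-μ * p.1)) := by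
  have hβ' : (β : ℂ) ≠ 0 := by exact_mod_cast hβ
  have hμ0 : μ ≠ 0 := by rintro rfl; simp at hμ; exact hβ' hμ.symm
  have key : ∀ ν : ℂ, ν ^ 2 = β → ∃ A : ℂ, ∀ p ∈ U,
      ((l p : ℂ) + γ / β + ν⁻¹ * m p) / 2 * Complex.exp (-ν * p.1) = A := by
    intro ν hν
    have hν0 : ν ≠ 0 := by rintro rfl; simp at hν; exact hβ' hν.symm
    have H := (((hl.ofReal.add (.const ((γ : ℂ) / β))).add (hm.ofReal.const_mul ν⁻¹)).const_mul
      (1 / 2)).mul (.of_fst (hasDerivAt_cexp_mul (-ν)))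
    obtain ⟨A, hA⟩ := (H.congr (g' := fun _ => 0) (h' := fun _ => 0) (fun p _ => by
      push_cast
      rw [← hν]
      field_simp
      ring) (fun p _ => by simp)).exists_eq_const hU hUc
    exact ⟨A, fun p hp => by rw [← hA p hp]; ring⟩
  obtain ⟨A, hA⟩ := key μ hμ
  obtain ⟨B, hB⟩ := key (-μ) (by rw [neg_sq, hμ])
  refine ⟨A, B, fun p hp => ?_⟩
  have e : Complex.exp (μ * p.1) * Complex.exp (-μ * p.1) = 1 := by
    rw [← Complex.exp_add]; simp
  rw [← hA p hp, ← hB p hp, neg_neg]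
  constructor
  · have : ∀ x y : ℂ, -(γ : ℂ) / β + x * Complex.exp (-μ * p.1) * Complex.exp (μ * p.1)
        + y * Complex.exp (μ * p.1) * Complex.exp (-μ * p.1) = -(γ : ℂ) / β + x + y := by
      intro x y; linear_combination (x + y) * e
    rw [this, inv_neg]; ring
  · have : ∀ x y : ℂ, x * Complex.exp (-μ * p.1) * Complex.exp (μ * p.1)
        - y * Complex.exp (μ * p.1) * Complex.exp (-μ * p.1) = x - y := by
      intro x y; linear_combination (x - y) * e
    rw [this, inv_neg]; field_simp; ring

theorem exists_trig_coeffs (hU : IsOpen U) (hUc : IsConnected U)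
    (hl : HasPartials U l m (fun _ => 0))
    (hm : HasPartials U m (fun p => β * l p + γ) (fun _ => 0)) (hβ : β ≠ 0) (hμ : μ ^ 2 = -β) :
    ∃ A B : ℂ, ∀ p ∈ U,
      (l p : ℂ) = -γ / β + A * Complex.cos (μ * p.1) + B * Complex.sin (μ * p.1) ∧
      (m p : ℂ) = μ * (B * Complex.cos (μ * p.1) - A * Complex.sin (μ * p.1)) := by
  obtain ⟨A, B, h⟩ := exists_exp_coeffs (μ := μ * Complex.I) hU hUc hl hm hβ
    (by rw [mul_pow, hμ, Complex.I_sq]; ring)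
  refine ⟨A + B, (A - B) * Complex.I, fun p hp => ?_⟩
  have e₁ : Complex.exp (μ * Complex.I * p.1)
      = Complex.cos (μ * p.1) + Complex.sin (μ * p.1) * Complex.I := by
    rw [← Complex.exp_mul_I]; ring_nf
  have e₂ : Complex.exp (-(μ * Complex.I) * p.1)
      = Complex.cos (μ * p.1) - Complex.sin (μ * p.1) * Complex.I := by
    have := Complex.exp_mul_I (-(μ * p.1))
    rw [Complex.cos_neg, Complex.sin_neg] at this
    rw [show -(μ * Complex.I) * p.1 = -(μ * p.1) * Complex.I by ring, this]; ring
  rw [(h p hp).1, (h p hp).2, e₁, e₂]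
  refine ⟨by ring, ?_⟩
  linear_combination μ * (A + B) * Complex.sin (μ * p.1) * Complex.I_sq

theorem exists_quadratic_coeffs (hU : IsOpen U) (hUc : IsConnected U)
    (hl : HasPartials U l m (fun _ => 0)) (hm : HasPartials U m (fun _ => γ) (fun _ => 0)) :
    ∃ A B : ℝ, ∀ p ∈ U, l p = γ / 2 * p.1 ^ 2 + A * p.1 + B ∧ m p = γ * p.1 + A := by
  have h1 : HasPartials U (fun p : ℝ × ℝ => p.1) (fun _ => 1) (fun _ => 0) :=
    .of_fst (φ := fun t => t) fun t => hasDerivAt_id t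
  obtain ⟨A, hA⟩ := ((hm.sub (h1.const_mul γ)).congr (g' := fun _ => 0) (h' := fun _ => 0)
    (fun p _ => by ring) (fun p _ => by ring)).exists_eq_const hU hUc
  obtain ⟨B, hB⟩ := ((hl.sub (((h1.mul h1).const_mul (γ / 2)).add (h1.const_mul A))).congr
    (g' := fun _ => 0) (h' := fun _ => 0)
    (fun p hp => by rw [← hA p hp]; ring) (fun p _ => by ring)).exists_eq_const hU hUc
  refine ⟨A, B, fun p hp => ⟨?_, ?_⟩⟩
  · rw [← hB p hp]; ring
  · rw [← hA p hp]; ring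

end Explicit

theorem complex_sqrt_sq (z : ℂ) : Complex.sqrt z ^ 2 = z := by
  have := Complex.cpow_nat_inv_pow z (n := 2) (by norm_num)
  simpa only [Complex.sqrt, Nat.cast_ofNat] using this

section Algebra
variable {K : Type*} [Field K] {η₁ η₂ b C : K}

/-- The Gauss equation for exponential functions: `P`, `Q` and `R`, `S` are the exponential terms
of `l₂` and of `l₁`. -/
theorem gauss_exp (hη₁ : η₁ ^ 2 = 1) (hη₂ : η₂ ^ 2 = 1) (hb : b ≠ 0) (hb' : 1 + b ≠ 0)
    {F G M N P Q R S : K} (hF : F = -C / b + P + Q) (hG : G = -C / (1 + b) + R + S)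
    (hM : M ^ 2 = η₁ * b * (P - Q) ^ 2) (hN : N ^ 2 = -η₂ * (1 + b) * (R - S) ^ 2) :
    b * (1 + b) * ((F - G) * (b * F + (1 + b) * G + 2 * C) - η₁ * M ^ 2 - η₂ * N ^ 2 - G * F) =
      -(C ^ 2 - 4 * b * (1 + b) * (b * (P * Q) - (1 + b) * (R * S))) := by
  rw [hM, hN, hF, hG]
  field_simp
  linear_combination (-(b * (1 + b) * b * (P - Q) ^ 2)) * hη₁ +
    b * (1 + b) * (1 + b) * (R - S) ^ 2 * hη₂

/-- The Gauss equation for `b = 0`, `C = η₁ c`: `l₂` is quadratic, `P` is the trigonometric part of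
`l₁`. -/
theorem gauss_quadratic_trig {c A B A' B' u F G M N P : K} (hη₁ : η₁ ^ 2 = 1) (hη₂ : η₂ ^ 2 = 1)
    (hF : 2 * F = c * u ^ 2 + 2 * A * u + 2 * B) (hM : M = c * u + A) (hG : G = -(η₁ * c) + P)
    (hN : N ^ 2 = η₂ * (A' ^ 2 + B' ^ 2 - P ^ 2)) :
    (F - G) * (G + 2 * (η₁ * c)) - η₁ * M ^ 2 - η₂ * N ^ 2 - G * F =
      -(η₁ * A ^ 2 - c ^ 2 - 2 * η₁ * c * B + A' ^ 2 + B' ^ 2) := by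
  rw [hN, hM, hG]
  linear_combination (η₁ * c) * hF - (A' ^ 2 + B' ^ 2 - P ^ 2) * hη₂ + c ^ 2 * hη₁

/-- The Gauss equation for `b = -1`, `C = -η₂ c`: `l₁` is quadratic, `P` is the trigonometric part of
`l₂`. -/
theorem gauss_trig_quadratic {c A B A' B' u F G M N P : K} (hη₁ : η₁ ^ 2 = 1) (hη₂ : η₂ ^ 2 = 1)
    (hG : 2 * G = c * u ^ 2 + 2 * A * u + 2 * B) (hN : N = c * u + A) (hF : F = -(η₂ * c) + P)
    (hM : M ^ 2 = η₁ * (A' ^ 2 + B' ^ 2 - P ^ 2)) :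
    (F - G) * (-F + 2 * (-(η₂ * c))) - η₁ * M ^ 2 - η₂ * N ^ 2 - G * F =
      -(η₂ * A ^ 2 - c ^ 2 - 2 * η₂ * c * B + A' ^ 2 + B' ^ 2) := by
  rw [hN, hM, hF]
  linear_combination (η₂ * c) * hG - (A' ^ 2 + B' ^ 2 - P ^ 2) * hη₁ + c ^ 2 * hη₂

end Algebra

theorem exp_mul_exp_neg_mul (μ z : ℂ) : Complex.exp (μ * z) * Complex.exp (-μ * z) = 1 := by
  rw [← Complex.exp_add]; simp

theorem sq_trig_deriv (A B z : ℂ) : (B * Complex.cos z - A * Complex.sin z) ^ 2 =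
    A ^ 2 + B ^ 2 - (A * Complex.cos z + B * Complex.sin z) ^ 2 := by
  linear_combination (A ^ 2 + B ^ 2) * Complex.cos_sq_add_sin_sq z

namespace IsDupinSolution
variable {η₁ η₂ b C : ℝ} {U : Set (ℝ × ℝ)} {l₁ l₂ m₁ m₂ : ℝ × ℝ → ℝ}

theorem explicitForm (hη₁ : η₁ ^ 2 = 1) (hη₂ : η₂ ^ 2 = 1) (hU : IsOpen U) (hUc : IsConnected U)
    (H : IsDupinSolution η₁ η₂ b C U l₁ l₂ m₁ m₂) : ExplicitForm η₁ η₂ U l₁ l₂ := by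
  have hη₁0 : η₁ ≠ 0 := by rintro rfl; norm_num at hη₁
  have hη₂0 : η₂ ≠ 0 := by rintro rfl; norm_num at hη₂
  have hη₁c : (η₁ : ℂ) ^ 2 = 1 := by exact_mod_cast hη₁
  have hη₂c : (η₂ : ℂ) ^ 2 = 1 := by exact_mod_cast hη₂
  have hη₁0c : (η₁ : ℂ) ≠ 0 := by exact_mod_cast hη₁0
  have hη₂0c : (η₂ : ℂ) ≠ 0 := by exact_mod_cast hη₂0
  obtain ⟨p₀, hp₀⟩ := hUc.nonempty
  have hG : ((l₂ p₀ : ℂ) - l₁ p₀) * (b * l₂ p₀ + (1 + b) * l₁ p₀ + 2 * C) - η₁ * m₂ p₀ ^ 2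
      - η₂ * m₁ p₀ ^ 2 - l₁ p₀ * l₂ p₀ = 0 := by exact_mod_cast H.gauss p₀ hp₀
  have hU' : IsOpen (Prod.swap ⁻¹' U) := hU.preimage continuous_swap
  have hUc' : IsConnected (Prod.swap ⁻¹' U) := by
    rw [← Set.image_swap_eq_preimage_swap]
    exact hUc.image _ continuous_swap.continuousOn
  have S₁ := H.partials_l₁.swap
  have S₂ := H.partials_m₁.swap
  have dv₁ : ∀ x y : ℂ, -(η₁ * x) / (η₁ * y) = -x / y := fun x y => by
    rw [← mul_neg, mul_div_mul_left _ _ hη₁0c]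
  by_cases hb : b = 0
  · subst hb
    right; left
    obtain ⟨A₅, A₆, h₂⟩ := exists_quadratic_coeffs (γ := η₁ * C) hU hUc H.partials_l₂
      (H.partials_m₂.congr (fun p _ => by ring) (fun p _ => rfl))
    obtain ⟨A₇, A₈, h₁⟩ := exists_trig_coeffs (μ := Complex.sqrt η₂) (β := -η₂) (γ := -η₂ * C)
      hU' hUc' S₁ (S₂.congr (fun p _ => by simp) (fun p _ => rfl)) (by simpa using hη₂0)
      (by rw [complex_sqrt_sq]; push_cast; ring)
    have h₁' : ∀ p ∈ U, (l₁ p : ℂ) = -(η₁ * (η₁ * C)) + (A₇ * Complex.cos (Complex.sqrt η₂ * p.2) +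
        A₈ * Complex.sin (Complex.sqrt η₂ * p.2)) := fun p hp => by
      have := (h₁ p.swap hp).1
      simp only [Function.comp_apply, Prod.swap_swap, Prod.fst_swap] at this
      rw [this]; push_cast
      rw [neg_mul, div_neg, neg_neg, mul_div_cancel_left₀ _ hη₂0c]
      linear_combination C * hη₁c
    refine ⟨η₁ * C, A₅, A₆, A₇, A₈, fun p hp => ⟨(h₂ p hp).1, ?_⟩, ?_⟩
    · rw [h₁' p hp]; push_cast; ring
    · have e₂ := (h₁ p₀.swap hp₀).2
      simp only [Function.comp_apply, Prod.swap_swap, Prod.fst_swap] at e₂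
      have hq := h₂ p₀ hp₀
      have key := gauss_quadratic_trig (K := ℂ) (c := η₁ * C) (A := A₅) (B := A₆) (A' := A₇)
        (B' := A₈) (u := p₀.1) (F := l₂ p₀) (M := m₂ p₀) (N := m₁ p₀) hη₁c hη₂c
        (by rw [hq.1]; push_cast; ring) (by rw [hq.2]; push_cast; ring) (h₁' p₀ hp₀)
        (by rw [e₂, mul_pow, complex_sqrt_sq, sq_trig_deriv])
      push_cast at key hG ⊢
      linear_combination key - hG - 2 * (l₂ p₀ - l₁ p₀) * C * hη₁c
  by_cases hb' : 1 + b = 0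
  · right; right; right
    obtain rfl : b = -1 := by linarith
    obtain ⟨B₇, B₈, h₁⟩ := exists_quadratic_coeffs (γ := -η₂ * C) hU' hUc' S₁
      (S₂.congr (fun p _ => by simp) (fun p _ => rfl))
    obtain ⟨B₅, B₆, h₂⟩ := exists_trig_coeffs (μ := Complex.sqrt η₁) (β := -η₁) (γ := η₁ * C)
      hU hUc H.partials_l₂ (H.partials_m₂.congr (fun p _ => by ring) (fun p _ => rfl))
      (by simpa using hη₁0) (by rw [complex_sqrt_sq]; push_cast; ring)
    have h₂' : ∀ p ∈ U, (l₂ p : ℂ) = -(η₂ * (-η₂ * C)) + (B₅ * Complex.cos (Complex.sqrt η₁ * p.1) +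
        B₆ * Complex.sin (Complex.sqrt η₁ * p.1)) := fun p hp => by
      rw [(h₂ p hp).1]; push_cast
      rw [neg_div_neg_eq, mul_div_cancel_left₀ _ hη₁0c]
      linear_combination -C * hη₂c
    refine ⟨-η₂ * C, B₇, B₈, B₅, B₆, fun p hp => ⟨?_, ?_⟩, ?_⟩
    · rw [h₂' p hp]; push_cast; ring
    · simpa using (h₁ p.swap hp).1
    · have hq := h₁ p₀.swap hp₀
      simp only [Function.comp_apply, Prod.swap_swap, Prod.fst_swap] at hq
      have key := gauss_trig_quadratic (K := ℂ) (c := -η₂ * C) (A := B₇) (B := B₈) (A' := B₅)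
        (B' := B₆) (u := p₀.2) (G := l₁ p₀) (M := m₂ p₀) (N := m₁ p₀) hη₁c hη₂c
        (by rw [hq.1]; push_cast; ring) (by rw [hq.2]; push_cast; ring) (h₂' p₀ hp₀)
        (by rw [(h₂ p₀ hp₀).2, mul_pow, complex_sqrt_sq, sq_trig_deriv])
      push_cast at key hG ⊢
      linear_combination key - hG - 2 * (l₂ p₀ - l₁ p₀) * C * hη₂c
  · left
    have hbc : (b : ℂ) ≠ 0 := by exact_mod_cast hb
    have hbc' : (1 + b : ℂ) ≠ 0 := by exact_mod_cast hb'
    obtain ⟨A₁, A₂, h₂⟩ := exists_exp_coeffs (μ := Complex.sqrt (b * η₁)) hU hUc H.partials_l₂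
      H.partials_m₂ (mul_ne_zero hη₁0 hb) (by rw [complex_sqrt_sq]; push_cast; ring)
    obtain ⟨A₃, A₄, h₁⟩ := exists_exp_coeffs (μ := Complex.sqrt (-η₂ * (1 + b))) hU' hUc' S₁ S₂
      (mul_ne_zero (neg_ne_zero.2 hη₂0) hb') (by rw [complex_sqrt_sq]; push_cast; ring)
    have h₂' : ∀ p ∈ U, (l₂ p : ℂ) = -C / b + A₁ * Complex.exp (Complex.sqrt (b * η₁) * p.1)
        + A₂ * Complex.exp (-Complex.sqrt (b * η₁) * p.1) := fun p hp => by
      rw [(h₂ p hp).1]; push_cast; rw [dv₁]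
    have h₁' : ∀ p ∈ U, (l₁ p : ℂ) = -C / (1 + b)
        + A₃ * Complex.exp (Complex.sqrt (-η₂ * (1 + b)) * p.2)
        + A₄ * Complex.exp (-Complex.sqrt (-η₂ * (1 + b)) * p.2) := fun p hp => by
      have := (h₁ p.swap hp).1
      simp only [Function.comp_apply, Prod.swap_swap, Prod.fst_swap] at this
      rw [this, show -((-η₂ * C : ℝ) : ℂ) / ((-η₂ * (1 + b) : ℝ) : ℂ) = -C / (1 + b) by
        push_cast; field_simp]
    refine ⟨b, η₁ * C, A₁, A₂, A₃, A₄, hb, hb', fun p hp => ⟨?_, ?_⟩, ?_⟩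
    · rw [h₂' p hp]; push_cast; rw [← mul_assoc, ← sq, hη₁c, one_mul]
    · rw [h₁' p hp]; push_cast; rw [← mul_assoc, ← sq, hη₁c, one_mul]
    · have e₂ := (h₁ p₀.swap hp₀).2
      simp only [Function.comp_apply, Prod.swap_swap, Prod.fst_swap] at e₂
      have key := gauss_exp (K := ℂ) (M := m₂ p₀) (N := m₁ p₀) hη₁c hη₂c hbc hbc' (h₂' p₀ hp₀)
        (h₁' p₀ hp₀) (by rw [(h₂ p₀ hp₀).2, mul_pow, complex_sqrt_sq]; ring)
        (by rw [e₂, mul_pow, complex_sqrt_sq])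
      have x₁ := exp_mul_exp_neg_mul (Complex.sqrt (b * η₁)) p₀.1
      have x₂ := exp_mul_exp_neg_mul (Complex.sqrt (-η₂ * (1 + b))) p₀.2
      rw [hG, mul_mul_mul_comm A₁, mul_mul_mul_comm A₃, x₁, x₂] at key
      push_cast
      linear_combination key + C ^ 2 * hη₁c

end IsDupinSolution

/-! ### From the explicit functions to the linear system -/

section FromExplicit
variable {U : Set (ℝ × ℝ)} {l : ℝ × ℝ → ℝ} {β γ : ℝ} {η₁ η₂ b C : ℝ} {l₁ l₂ m₁ m₂ : ℝ × ℝ → ℝ}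

/-- The derivative of the complex expression `F` takes real values wherever `l` is defined, because
`U` is open; outside of the projection of `U` the values of `F` need not be real. -/
theorem exists_partials_of_complex (hU : IsOpen U) {F F' : ℝ → ℂ}
    (hF : ∀ t, HasDerivAt F (F' t) t) (hF' : ∀ t, HasDerivAt F' (β * F t + γ) t)
    (hl : ∀ p ∈ U, (l p : ℂ) = F p.1) :
    ∃ m : ℝ × ℝ → ℝ, HasPartials U l m (fun _ => 0) ∧
      HasPartials U m (fun p => β * l p + γ) (fun _ => 0) ∧ ∀ p ∈ U, (m p : ℂ) = F' p.1 := by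
  have P : HasPartials U (fun p => F p.1) (fun p => F' p.1) (fun _ => 0) := .of_fst hF
  have P' : HasPartials U (fun p => F' p.1) (fun p => β * F p.1 + γ) (fun _ => 0) := .of_fst hF'
  refine ⟨fun p => (F' p.1).re, ?_, ?_, fun p hp => ?_⟩
  · refine ((P.comp_clm Complex.reCLM).congr_fun hU fun p hp => ?_).congr (fun _ _ => rfl)
      (fun p _ => map_zero _)
    simp [← hl p hp]
  · refine (P'.comp_clm Complex.reCLM).congr (fun p hp => ?_) (fun p _ => map_zero _)
    simp [← hl p hp]
  · have h₁ : HasDerivAt (fun t => (F t).im) (F' p.1).im p.1 :=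
      Complex.imCLM.hasFDerivAt.comp_hasDerivAt _ (hF p.1)
    have h₂ : HasDerivAt (fun t => (F t).im) 0 p.1 :=
      (hasDerivAt_const p.1 (0 : ℝ)).congr_of_eventuallyEq
        ((eventually_mem_fst hU hp).mono fun t ht => by
          change (F t).im = 0
          rw [show F t = l (t, p.2) from (hl _ ht).symm, Complex.ofReal_im])
    exact Complex.ext rfl (by simpa using (h₁.unique h₂).symm)

theorem exists_partials_of_exp (hU : IsOpen U) {μ A B κ : ℂ} (hμ : μ ^ 2 = β) (hκ : β * κ = -γ)
    (hl : ∀ p ∈ U, (l p : ℂ) = κ + A * Complex.exp (μ * p.1) + B * Complex.exp (-μ * p.1)) :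
    ∃ m : ℝ × ℝ → ℝ, HasPartials U l m (fun _ => 0) ∧
      HasPartials U m (fun p => β * l p + γ) (fun _ => 0) ∧
      ∀ p ∈ U, (m p : ℂ) = μ * (A * Complex.exp (μ * p.1) - B * Complex.exp (-μ * p.1)) := by
  refine exists_partials_of_complex hU
    (F := fun t => κ + A * Complex.exp (μ * t) + B * Complex.exp (-μ * t))
    (F' := fun t => μ * (A * Complex.exp (μ * t) - B * Complex.exp (-μ * t)))
    (fun t => ?_) (fun t => ?_) hl
  · refine ((((hasDerivAt_cexp_mul μ t).const_mul A).const_add κ).add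
      ((hasDerivAt_cexp_mul (-μ) t).const_mul B)).congr_deriv ?_
    ring
  · refine ((((hasDerivAt_cexp_mul μ t).const_mul A).sub
      ((hasDerivAt_cexp_mul (-μ) t).const_mul B)).const_mul μ).congr_deriv ?_
    rw [← hμ] at hκ ⊢
    linear_combination -hκ

theorem exists_partials_of_trig (hU : IsOpen U) {μ A B κ : ℂ} (hμ : μ ^ 2 = -β) (hκ : β * κ = -γ)
    (hl : ∀ p ∈ U, (l p : ℂ) = κ + A * Complex.cos (μ * p.1) + B * Complex.sin (μ * p.1)) :
    ∃ m : ℝ × ℝ → ℝ, HasPartials U l m (fun _ => 0) ∧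
      HasPartials U m (fun p => β * l p + γ) (fun _ => 0) ∧
      ∀ p ∈ U, (m p : ℂ) = μ * (B * Complex.cos (μ * p.1) - A * Complex.sin (μ * p.1)) := by
  have hc : ∀ t : ℝ, HasDerivAt (fun t : ℝ => Complex.cos (μ * t)) (-(μ * Complex.sin (μ * t))) t :=
    fun t => by
      have : HasDerivAt (fun z : ℂ => Complex.cos (μ * z)) (-(μ * Complex.sin (μ * t))) (t : ℂ) := by
        simpa [mul_comm] using ((hasDerivAt_id (t : ℂ)).const_mul μ).ccos
      exact this.comp_ofReal
  have hs : ∀ t : ℝ, HasDerivAt (fun t : ℝ => Complex.sin (μ * t)) (μ * Complex.cos (μ * t)) t :=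
    fun t => by
      have : HasDerivAt (fun z : ℂ => Complex.sin (μ * z)) (μ * Complex.cos (μ * t)) (t : ℂ) := by
        simpa [mul_comm] using ((hasDerivAt_id (t : ℂ)).const_mul μ).csin
      exact this.comp_ofReal
  refine exists_partials_of_complex hU
    (F := fun t => κ + A * Complex.cos (μ * t) + B * Complex.sin (μ * t))
    (F' := fun t => μ * (B * Complex.cos (μ * t) - A * Complex.sin (μ * t)))
    (fun t => ?_) (fun t => ?_) hl
  · refine ((((hc t).const_mul A).const_add κ).add ((hs t).const_mul B)).congr_deriv ?_
    ring
  · refine ((((hc t).const_mul B).sub ((hs t).const_mul A)).const_mul μ).congr_deriv ?_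
    have hβ : (β : ℂ) = -μ ^ 2 := by rw [hμ, neg_neg]
    rw [hβ] at hκ ⊢
    linear_combination -hκ

theorem exists_partials_of_quadratic (hU : IsOpen U) {A B : ℝ}
    (hl : ∀ p ∈ U, l p = γ / 2 * p.1 ^ 2 + A * p.1 + B) :
    ∃ m : ℝ × ℝ → ℝ, HasPartials U l m (fun _ => 0) ∧
      HasPartials U m (fun _ => γ) (fun _ => 0) ∧ ∀ p ∈ U, m p = γ * p.1 + A := by
  refine ⟨fun p => γ * p.1 + A, ?_, ?_, fun _ _ => rfl⟩
  · refine HasPartials.congr_fun hU (.of_fst (φ := fun t => γ / 2 * t ^ 2 + A * t + B)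
      (φ' := fun t => γ * t + A) fun t => ?_) hl
    refine ((((hasDerivAt_id t).pow 2).const_mul (γ / 2)).add
      ((hasDerivAt_id t).const_mul A) |>.add_const B).congr_deriv ?_
    simp; ring
  · refine .of_fst (φ := fun t => γ * t + A) (φ' := fun _ => γ) fun t => ?_
    refine (((hasDerivAt_id t).const_mul γ).add_const A).congr_deriv (mul_one γ)

theorem IsDupinSolution.mk_of_swap {k₁ : ℝ × ℝ → ℝ} {β₂ γ₂ β₁ γ₁ : ℝ}
    (hβ₂ : β₂ = η₁ * b) (hγ₂ : γ₂ = η₁ * C) (hβ₁ : β₁ = -η₂ * (1 + b)) (hγ₁ : γ₁ = -η₂ * C)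
    (h₂ : HasPartials U l₂ m₂ (fun _ => 0))
    (h₂' : HasPartials U m₂ (fun p => β₂ * l₂ p + γ₂) (fun _ => 0))
    (h₁ : HasPartials (Prod.swap ⁻¹' U) (l₁ ∘ Prod.swap) k₁ (fun _ => 0))
    (h₁' : HasPartials (Prod.swap ⁻¹' U) k₁ (fun p => β₁ * (l₁ ∘ Prod.swap) p + γ₁) (fun _ => 0))
    (hG : ∀ p ∈ U, (l₂ p - l₁ p) * (b * l₂ p + (1 + b) * l₁ p + 2 * C) - η₁ * m₂ p ^ 2
      - η₂ * k₁ p.swap ^ 2 - l₁ p * l₂ p = 0) :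
    IsDupinSolution η₁ η₂ b C U l₁ l₂ (k₁ ∘ Prod.swap) m₂ := by
  subst hβ₂ hγ₂ hβ₁ hγ₁
  exact ⟨h₂, h₂', h₁.swap, h₁'.swap, hG⟩

/-- The case `b₂` is the case `b₁` with `b₁ = -(1 + b₂)` and `c₁ = -η₁ η₂ c₂`. -/
theorem CaseThree.caseOne (hη₁ : η₁ ^ 2 = 1) (hη₂ : η₂ ^ 2 = 1) (H : CaseThree η₁ η₂ U l₁ l₂) :
    CaseOne η₁ η₂ U l₁ l₂ := by
  obtain ⟨b, c, B₁, B₂, B₃, B₄, hb, hb', h, hc⟩ := H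
  have hη₁c : (η₁ : ℂ) ^ 2 = 1 := by exact_mod_cast hη₁
  have hη₂c : (η₂ : ℂ) ^ 2 = 1 := by exact_mod_cast hη₂
  have hbc : (b : ℂ) ≠ 0 := by exact_mod_cast hb
  have hbc' : (1 + b : ℂ) ≠ 0 := by exact_mod_cast hb'
  refine ⟨-(1 + b), -(η₁ * η₂ * c), B₁, B₂, B₃, B₄, neg_ne_zero.2 hb', ?_, fun p hp => ⟨?_, ?_⟩, ?_⟩
  · simpa using hb
  · rw [(h p hp).1]; push_cast
    rw [show -(1 + b : ℂ) * η₁ = -η₁ * (1 + b) by ring]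
    congr 2
    field_simp
    linear_combination η₂ * c * hη₁c
  · rw [(h p hp).2]; push_cast
    rw [show -(η₂ : ℂ) * (1 + -(1 + b)) = b * η₂ by ring, show (1 : ℂ) + -(1 + b) = -b by ring]
    congr 2
    field_simp
    linear_combination η₂ * c * hη₁c
  · push_cast
    linear_combination hc + c ^ 2 * η₂ ^ 2 * hη₁c + c ^ 2 * hη₂c

theorem CaseOne.exists_isDupinSolution (hη₁ : η₁ ^ 2 = 1) (hη₂ : η₂ ^ 2 = 1) (hU : IsOpen U)
    (H : CaseOne η₁ η₂ U l₁ l₂) : ∃ b C m₁ m₂, IsDupinSolution η₁ η₂ b C U l₁ l₂ m₁ m₂ := by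
  have hη₁c : (η₁ : ℂ) ^ 2 = 1 := by exact_mod_cast hη₁
  have hη₂c : (η₂ : ℂ) ^ 2 = 1 := by exact_mod_cast hη₂
  obtain ⟨b, c, A₁, A₂, A₃, A₄, hb, hb', h, hc⟩ := H
  have hbc : (b : ℂ) ≠ 0 := by exact_mod_cast hb
  have hbc' : (1 + b : ℂ) ≠ 0 := by exact_mod_cast hb'
  obtain ⟨m₂, h₂, h₂', e₂⟩ := exists_partials_of_exp (β := η₁ * b) (γ := η₁ * (η₁ * c)) hU
    (μ := Complex.sqrt (b * η₁)) (by rw [complex_sqrt_sq]; push_cast; ring)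
    (by push_cast; field_simp) (fun p hp => (h p hp).1)
  obtain ⟨k₁, h₁, h₁', e₁⟩ := exists_partials_of_exp (l := l₁ ∘ Prod.swap)
    (β := -η₂ * (1 + b)) (γ := -η₂ * (η₁ * c)) (hU.preimage continuous_swap)
    (μ := Complex.sqrt (-η₂ * (1 + b))) (by rw [complex_sqrt_sq]; push_cast; ring)
    (by push_cast; field_simp) (fun p hp => (h p.swap hp).2)
  refine ⟨b, η₁ * c, _, m₂, .mk_of_swap rfl rfl rfl rfl h₂ h₂' h₁ h₁' fun p hp => ?_⟩
  have key := gauss_exp (K := ℂ) (C := η₁ * c) (F := l₂ p) (G := l₁ p) (M := m₂ p)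
    (N := k₁ p.swap) hη₁c hη₂c hbc hbc' (h p hp).1 (h p hp).2
    (by rw [e₂ p hp, mul_pow, complex_sqrt_sq]; ring)
    (by rw [e₁ p.swap hp, mul_pow, complex_sqrt_sq]; rfl)
  rw [mul_mul_mul_comm A₁, mul_mul_mul_comm A₃, exp_mul_exp_neg_mul, exp_mul_exp_neg_mul,
    mul_pow, hη₁c] at key
  have z : (b : ℂ) * (1 + b) * ((l₂ p - l₁ p) * (b * l₂ p + (1 + b) * l₁ p + 2 * (η₁ * c))
      - η₁ * m₂ p ^ 2 - η₂ * k₁ p.swap ^ 2 - l₁ p * l₂ p) = 0 := by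
    linear_combination key - hc
  have z' := (mul_eq_zero.1 z).resolve_left (mul_ne_zero hbc hbc')
  exact_mod_cast z'

theorem CaseTwo.exists_isDupinSolution (hη₁ : η₁ ^ 2 = 1) (hη₂ : η₂ ^ 2 = 1) (hU : IsOpen U)
    (H : CaseTwo η₁ η₂ U l₁ l₂) : ∃ b C m₁ m₂, IsDupinSolution η₁ η₂ b C U l₁ l₂ m₁ m₂ := by
  have hη₁c : (η₁ : ℂ) ^ 2 = 1 := by exact_mod_cast hη₁
  have hη₂c : (η₂ : ℂ) ^ 2 = 1 := by exact_mod_cast hη₂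
  obtain ⟨c, A₅, A₆, A₇, A₈, h, hc⟩ := H
  obtain ⟨m₂, h₂, h₂', e₂⟩ := exists_partials_of_quadratic hU (fun p hp => (h p hp).1)
  obtain ⟨k₁, h₁, h₁', e₁⟩ := exists_partials_of_trig (l := l₁ ∘ Prod.swap)
    (β := -η₂) (γ := -η₂ * (η₁ * c)) (hU.preimage continuous_swap)
    (μ := Complex.sqrt η₂) (by rw [complex_sqrt_sq]; push_cast; ring)
    (by push_cast; ring) (fun p hp => (h p.swap hp).2)
  refine ⟨0, η₁ * c, _, m₂, .mk_of_swap (β₂ := 0) (by ring) (by rw [← mul_assoc, ← sq, hη₁, one_mul])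
    (by ring) rfl h₂ (h₂'.congr (fun p _ => by ring) (fun _ _ => rfl)) h₁ h₁' fun p hp => ?_⟩
  have key := gauss_quadratic_trig (K := ℂ) (c := c) (A := A₅) (B := A₆) (A' := A₇)
    (B' := A₈) (u := p.1) (F := l₂ p) (G := l₁ p) (M := m₂ p) (N := k₁ p.swap) hη₁c hη₂c
    (by rw [(h p hp).1]; push_cast; ring) (by rw [e₂ p hp]; push_cast; ring)
    ((h p hp).2.trans (add_assoc _ _ _))
    (by rw [e₁ p.swap hp, mul_pow, complex_sqrt_sq, sq_trig_deriv]; rfl)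
  have z : ((l₂ p : ℂ) - l₁ p) * (l₁ p + 2 * (η₁ * c))
      - η₁ * m₂ p ^ 2 - η₂ * k₁ p.swap ^ 2 - l₁ p * l₂ p = 0 := by
    linear_combination key - hc
  have z' : (l₂ p - l₁ p) * (l₁ p + 2 * (η₁ * c))
      - η₁ * m₂ p ^ 2 - η₂ * k₁ p.swap ^ 2 - l₁ p * l₂ p = 0 := by exact_mod_cast z
  linear_combination z'

theorem CaseFour.exists_isDupinSolution (hη₁ : η₁ ^ 2 = 1) (hη₂ : η₂ ^ 2 = 1) (hU : IsOpen U)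
    (H : CaseFour η₁ η₂ U l₁ l₂) : ∃ b C m₁ m₂, IsDupinSolution η₁ η₂ b C U l₁ l₂ m₁ m₂ := by
  have hη₁c : (η₁ : ℂ) ^ 2 = 1 := by exact_mod_cast hη₁
  have hη₂c : (η₂ : ℂ) ^ 2 = 1 := by exact_mod_cast hη₂
  obtain ⟨c, B₇, B₈, B₅, B₆, h, hc⟩ := H
  obtain ⟨k₁, h₁, h₁', e₁⟩ := exists_partials_of_quadratic (l := l₁ ∘ Prod.swap)
    (hU.preimage continuous_swap) (fun p hp => (h p.swap hp).2)
  obtain ⟨m₂, h₂, h₂', e₂⟩ := exists_partials_of_trig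
    (β := -η₁) (γ := η₁ * -(η₂ * c)) hU
    (μ := Complex.sqrt η₁) (by rw [complex_sqrt_sq]; push_cast; ring)
    (by push_cast; ring) (fun p hp => (h p hp).1)
  refine ⟨-1, -(η₂ * c), _, m₂, .mk_of_swap (β₁ := 0) (γ₁ := c) (by ring) rfl (by ring)
    (by linear_combination -c * hη₂) h₂ h₂' h₁
    (h₁'.congr (fun p _ => by ring) (fun _ _ => rfl)) fun p hp => ?_⟩
  have e₁' := e₁ p.swap hp
  have key := gauss_trig_quadratic (K := ℂ) (c := c) (A := B₇) (B := B₈) (A' := B₅)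
    (B' := B₆) (u := p.2) (F := l₂ p) (G := l₁ p) (M := m₂ p) (N := k₁ p.swap) hη₁c hη₂c
    (by rw [(h p hp).2]; push_cast; ring) (by rw [e₁']; push_cast; rfl)
    ((h p hp).1.trans (add_assoc _ _ _))
    (by rw [e₂ p hp, mul_pow, complex_sqrt_sq, sq_trig_deriv])
  have z : ((l₂ p : ℂ) - l₁ p) * (-l₂ p + 2 * (-(η₂ * c)))
      - η₁ * m₂ p ^ 2 - η₂ * k₁ p.swap ^ 2 - l₁ p * l₂ p = 0 := by
    linear_combination key - hc
  have z' : (l₂ p - l₁ p) * (-l₂ p + 2 * (-(η₂ * c)))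
      - η₁ * m₂ p ^ 2 - η₂ * k₁ p.swap ^ 2 - l₁ p * l₂ p = 0 := by exact_mod_cast z
  linear_combination z'

/-- The system has `b = 0` if `l₁ = 0` and `b = -1` if `l₂ = 0`. -/
theorem ConstantCase.exists_isDupinSolution (hU : IsOpen U) (H : ConstantCase U l₁ l₂) :
    ∃ b C m₁ m₂, IsDupinSolution η₁ η₂ b C U l₁ l₂ m₁ m₂ := by
  obtain ⟨k₁, k₂, hk, h⟩ := H
  have P₁ : HasPartials U l₁ (fun _ => 0) (fun _ => 0) :=
    (HasPartials.const k₁).congr_fun hU fun p hp => (h p hp).1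
  have P₂ : HasPartials U l₂ (fun _ => 0) (fun _ => 0) :=
    (HasPartials.const k₂).congr_fun hU fun p hp => (h p hp).2
  rcases mul_eq_zero.1 hk with rfl | rfl
  · refine ⟨0, 0, fun _ => 0, fun _ => 0, P₂, ?_, P₁, ?_, fun p hp => ?_⟩
    · exact (HasPartials.const 0).congr (fun p _ => by ring) (fun p _ => by ring)
    · exact (HasPartials.const 0).congr (fun p _ => by ring) (fun p hp => by rw [(h p hp).1]; ring)
    · rw [(h p hp).1]; ring
  · refine ⟨-1, 0, fun _ => 0, fun _ => 0, P₂, ?_, P₁, ?_, fun p hp => ?_⟩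
    · exact (HasPartials.const 0).congr (fun p hp => by rw [(h p hp).2]; ring) (fun p _ => by ring)
    · exact (HasPartials.const 0).congr (fun p _ => by ring) (fun p _ => by ring)
    · rw [(h p hp).2]; ring

theorem exists_isDupinSolution (hη₁ : η₁ ^ 2 = 1) (hη₂ : η₂ ^ 2 = 1) (hU : IsOpen U)
    (H : ConstantCase U l₁ l₂ ∨ ExplicitForm η₁ η₂ U l₁ l₂) :
    ∃ b C m₁ m₂, IsDupinSolution η₁ η₂ b C U l₁ l₂ m₁ m₂ := by
  rcases H with H | H | H | H | H
  · exact H.exists_isDupinSolution hU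
  · exact H.exists_isDupinSolution hη₁ hη₂ hU
  · exact H.exists_isDupinSolution hη₁ hη₂ hU
  · exact (H.caseOne hη₁ hη₂).exists_isDupinSolution hη₁ hη₂ hU
  · exact H.exists_isDupinSolution hη₁ hη₂ hU

end FromExplicit

/-! ### Second order equations with constant coefficients -/

section Fundamental

/-- The solutions of `s'' = β s` and `d' = s` with `s = d = 0` and `s' = 1` at `a`. The equation for
`s'` is integrated once. -/
theorem exists_fundamental_solution (β a : ℝ) : ∃ s d : ℝ → ℝ, ContDiff ℝ ∞ s ∧ ContDiff ℝ ∞ d ∧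
    (∀ t, HasDerivAt d (s t) t) ∧ (∀ t, HasDerivAt s (1 + β * d t) t) ∧ s a = 0 ∧ d a = 0 := by
  rcases lt_trichotomy β 0 with hβ | rfl | hβ
  · obtain ⟨k, hk, rfl⟩ : ∃ k : ℝ, k ≠ 0 ∧ β = -k ^ 2 :=
      ⟨√(-β), (Real.sqrt_pos.2 (neg_pos.2 hβ)).ne', by rw [Real.sq_sqrt (neg_pos.2 hβ).le, neg_neg]⟩
    have h : ∀ t : ℝ, HasDerivAt (fun t => k * (t - a)) k t := fun t => by
      simpa using ((hasDerivAt_id t).sub_const a).const_mul k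
    refine ⟨fun t => Real.sin (k * (t - a)) / k, fun t => (1 - Real.cos (k * (t - a))) / k ^ 2,
      by fun_prop, by fun_prop, fun t => ?_, fun t => ?_, by simp, by simp⟩
    · refine (((h t).cos.const_sub 1).div_const (k ^ 2)).congr_deriv ?_
      field_simp
    · refine ((h t).sin.div_const k).congr_deriv ?_
      field_simp; ring
  · have h : ∀ t : ℝ, HasDerivAt (fun t => t - a) 1 t := fun t => (hasDerivAt_id t).sub_const a
    refine ⟨fun t => t - a, fun t => (t - a) ^ 2 / 2, by fun_prop, by fun_prop, fun t => ?_,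
      fun t => by simpa using h t, by simp, by simp⟩
    refine (((h t).pow 2).div_const 2).congr_deriv ?_
    simp
  · obtain ⟨k, hk, rfl⟩ : ∃ k : ℝ, k ≠ 0 ∧ β = k ^ 2 :=
      ⟨√β, (Real.sqrt_pos.2 hβ).ne', by rw [Real.sq_sqrt hβ.le]⟩
    have h : ∀ t : ℝ, HasDerivAt (fun t => k * (t - a)) k t := fun t => by
      simpa using ((hasDerivAt_id t).sub_const a).const_mul k
    refine ⟨fun t => Real.sinh (k * (t - a)) / k, fun t => (Real.cosh (k * (t - a)) - 1) / k ^ 2,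
      by fun_prop, by fun_prop, fun t => ?_, fun t => ?_, by simp, by simp⟩
    · refine (((h t).cosh.sub_const 1).div_const (k ^ 2)).congr_deriv ?_
      field_simp
    · refine ((h t).sinh.div_const k).congr_deriv ?_
      field_simp; ring

variable {β a : ℝ} {s d : ℝ → ℝ}

/-- The first integral `s' ^ 2 - β s ^ 2 = 1`, divided by `β`. -/
theorem fundamental_sq (hd : ∀ t, HasDerivAt d (s t) t) (hs : ∀ t, HasDerivAt s (1 + β * d t) t)
    (hsa : s a = 0) (hda : d a = 0) (t : ℝ) : s t ^ 2 = β * d t ^ 2 + 2 * d t := by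
  have H : ∀ t, HasDerivAt (fun t => s t ^ 2 - (β * d t ^ 2 + 2 * d t)) 0 t := fun t => by
    refine (((hs t).pow 2).sub ((((hd t).pow 2).const_mul β).add ((hd t).const_mul 2))).congr_deriv ?_
    norm_num; ring
  have := is_const_of_deriv_eq_zero (fun t => (H t).differentiableAt) (fun t => (H t).deriv) t a
  simp only [hsa, hda] at this
  linear_combination this

/-- On a connected set which is not convex the solution may be a function of `u₁` only locally; the
formula shows that the initial values at one point determine it on the whole set. -/
theorem HasPartials.eq_fundamental {U : Set (ℝ × ℝ)} (hU : IsOpen U) (hUc : IsConnected U)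
    {l m : ℝ × ℝ → ℝ} {γ : ℝ} {p₀ : ℝ × ℝ} (hp₀ : p₀ ∈ U) (hl : HasPartials U l m (fun _ => 0))
    (hm : HasPartials U m (fun p => β * l p + γ) (fun _ => 0))
    (hd : ∀ t, HasDerivAt d (s t) t) (hs : ∀ t, HasDerivAt s (1 + β * d t) t)
    (hsa : s p₀.1 = 0) (hda : d p₀.1 = 0) :
    ∀ p ∈ U, l p = l p₀ + s p.1 * m p₀ + d p.1 * (β * l p₀ + γ) := by
  have Ps : HasPartials U (fun p => s p.1) (fun p => 1 + β * d p.1) (fun _ => 0) := .of_fst hs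
  have Pd : HasPartials U (fun p => d p.1) (fun p => s p.1) (fun _ => 0) := .of_fst hd
  have Pc := (HasPartials.const (U := U) (1 : ℝ)).add (Pd.const_mul β)
  set n := β * l p₀ + γ
  -- The difference `w` of the two sides and its derivative `w'`; the constant quantities
  -- `w s' - w' s` and `w' s' - β w s` vanish at `p₀`, and `s' ^ 2 - β * s ^ 2 = 1`.
  have Pw := hl.sub (((Ps.const_mul (m p₀)).add (Pd.const_mul n)).add (.const (l p₀)))
  have Pw' := hm.sub ((Pc.const_mul (m p₀)).add (Ps.const_mul n))
  obtain ⟨c₁, h₁⟩ := (((Pw.mul Pc).sub (Pw'.mul Ps)).congr (g' := fun _ => 0) (h' := fun _ => 0)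
    (fun p _ => by simp only [n]; ring) (fun p _ => by ring)).exists_eq_const hU hUc
  obtain ⟨c₂, h₂⟩ := (((Pw'.mul Pc).sub ((Pw.mul Ps).const_mul β)).congr (g' := fun _ => 0)
    (h' := fun _ => 0) (fun p _ => by simp only [n]; ring) (fun p _ => by ring)).exists_eq_const
    hU hUc
  have z₁ := h₁ p₀ hp₀
  have z₂ := h₂ p₀ hp₀
  simp only [hsa, hda] at z₁ z₂
  intro p hp
  have e₁ := h₁ p hp
  have e₂ := h₂ p hp
  have e := fundamental_sq hd hs hsa hda p.1
  linear_combination (1 + β * d p.1) * (e₁ - z₁) + s p.1 * (e₂ - z₂) +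
    (l p - (m p₀ * s p.1 + n * d p.1 + l p₀)) * β * e

end Fundamental

/-! ### The pseudo-Euclidean product -/

section Pinner
variable {ε : Fin 3 → ℝ}

theorem pinner_comm (x y : E3) : pinner ε x y = pinner ε y x := by simp only [pinner]; ring

theorem pinner_sub_left (x y z : E3) : pinner ε (x - y) z = pinner ε x z - pinner ε y z := by
  simp only [pinner, Pi.sub_apply]; ring

theorem pinner_smul_left (c : ℝ) (x z : E3) : pinner ε (c • x) z = c * pinner ε x z := by
  simp only [pinner, Pi.smul_apply, smul_eq_mul]; ring

theorem pinner_add_right (x y z : E3) : pinner ε z (x + y) = pinner ε z x + pinner ε z y := by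
  simp only [pinner, Pi.add_apply]; ring

theorem pinner_sub_right (x y z : E3) : pinner ε z (x - y) = pinner ε z x - pinner ε z y := by
  simp only [pinner, Pi.sub_apply]; ring

theorem pinner_smul_right (c : ℝ) (x z : E3) : pinner ε z (c • x) = c * pinner ε z x := by
  simp only [pinner, Pi.smul_apply, smul_eq_mul]; ring

theorem HasDerivAt.pinner {f g : ℝ → E3} {f' g' : E3} {t : ℝ} (hf : HasDerivAt f f' t)
    (hg : HasDerivAt g g' t) :
    HasDerivAt (fun t => pinner ε (f t) (g t)) (pinner ε f' (g t) + pinner ε (f t) g') t := by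
  have F := hasDerivAt_pi.1 hf
  have G := hasDerivAt_pi.1 hg
  refine (((((F 0).const_mul (ε 0)).mul (G 0)).add (((F 1).const_mul (ε 1)).mul (G 1))).add
    (((F 2).const_mul (ε 2)).mul (G 2))).congr_deriv ?_
  simp only [_root_.pinner]; ring

theorem linearIndependent_pair_of_pinner {x y : E3} (hx : pinner ε x x ≠ 0) (hy : pinner ε y y ≠ 0)
    (hxy : pinner ε x y = 0) : LinearIndependent ℝ ![x, y] := by
  refine LinearIndependent.pair_iff.2 fun a b h => ?_
  have h₁ : pinner ε x (a • x + b • y) = 0 := by rw [h]; simp [pinner]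
  have h₂ : pinner ε y (a • x + b • y) = 0 := by rw [h]; simp [pinner]
  rw [pinner_add_right, pinner_smul_right, pinner_smul_right, hxy] at h₁
  rw [pinner_add_right, pinner_smul_right, pinner_smul_right, pinner_comm y x, hxy] at h₂
  exact ⟨by simpa [hx] using h₁, by simpa [hy] using h₂⟩

end Pinner

/-! ### Surfaces from their curvature spheres -/

/-- The curvature spheres `K = l₂ X - N` and `L = l₁ X - N` of a Dupin surface are functions of one
variable each, and they determine the surface. Conversely, curves `K`, `L` with the listed scalar
products, which say that the lifts `(K, κ, f, 1)` and `(L, ℓ, g, 1)` to the Lie quadric are null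
curves orthogonal to each other, are the curvature spheres of a surface. -/
theorem isIsothermicDupin_of_curvature_spheres {ε : Fin 3 → ℝ} (hε : ∀ i, ε i ≠ 0)
    {U : Set (ℝ × ℝ)} (hU : IsOpen U)
    {K L K' L' : ℝ → E3} {κ ℓ f g κ' ℓ' f' g' : ℝ → ℝ}
    (cK : ContDiff ℝ ∞ K) (cL : ContDiff ℝ ∞ L) (cf : ContDiff ℝ ∞ f) (cg : ContDiff ℝ ∞ g)
    (dK : ∀ t, HasDerivAt K (K' t) t) (dL : ∀ t, HasDerivAt L (L' t) t)
    (dκ : ∀ t, HasDerivAt κ (κ' t) t) (dℓ : ∀ t, HasDerivAt ℓ (ℓ' t) t)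
    (df : ∀ t, HasDerivAt f (f' t) t) (dg : ∀ t, HasDerivAt g (g' t) t)
    (KK : ∀ t, pinner ε (K t) (K t) = f t * κ t + ε 2)
    (LL : ∀ t, pinner ε (L t) (L t) = g t * ℓ t + ε 2)
    (KL : ∀ t u, 2 * pinner ε (K t) (L u) = f t * ℓ u + g u * κ t + 2 * ε 2)
    (KK' : ∀ t, pinner ε (K' t) (K' t) = f' t * κ' t + ε 0)
    (LL' : ∀ t, pinner ε (L' t) (L' t) = g' t * ℓ' t + ε 1)
    {lam₁ lam₂ : ℝ × ℝ → ℝ} (h₁ : ∀ p ∈ U, lam₁ p = g p.2) (h₂ : ∀ p ∈ U, lam₂ p = f p.1)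
    (hne : ∀ p ∈ U, lam₁ p ≠ lam₂ p) :
    ∃ X N : ℝ × ℝ → E3, IsIsothermicDupin ε U X N lam₁ lam₂ := by
  have hφ : ∀ p ∈ U, f p.1 - g p.2 ≠ 0 := fun p hp => by
    rw [← h₁ p hp, ← h₂ p hp]; exact sub_ne_zero.2 (hne p hp).symm
  set X : ℝ × ℝ → E3 := fun p => (f p.1 - g p.2)⁻¹ • (K p.1 - L p.2) with hX
  set N : ℝ × ℝ → E3 := fun p => g p.2 • X p - L p.2 with hN
  have sX : ContDiffOn ℝ ∞ X U :=
    ((((cf.comp contDiff_fst).sub (cg.comp contDiff_snd)).contDiffOn).inv hφ).smul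
      ((cK.comp contDiff_fst).sub (cL.comp contDiff_snd)).contDiffOn
  have sN : ContDiffOn ℝ ∞ N U :=
    ((cg.comp contDiff_snd).contDiffOn.smul sX).sub (cL.comp contDiff_snd).contDiffOn
  have dX₁ : ∀ p ∈ U, HasDerivAt (fun t => X (t, p.2))
      ((f p.1 - g p.2)⁻¹ • (K' p.1 - f' p.1 • X p)) p.1 := fun p hp => by
    refine ((((df p.1).sub_const (g p.2)).inv (hφ p hp)).smul
      ((dK p.1).sub_const (L p.2))).congr_deriv ?_
    have := hφ p hp
    ext i
    simp only [hX, Pi.inv_apply, Pi.add_apply, Pi.smul_apply, Pi.sub_apply, smul_eq_mul]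
    field_simp; ring
  have dX₂ : ∀ p ∈ U, HasDerivAt (fun t => X (p.1, t))
      ((f p.1 - g p.2)⁻¹ • (g' p.2 • X p - L' p.2)) p.2 := fun p hp => by
    refine ((((dg p.2).const_sub (f p.1)).inv (hφ p hp)).smul
      ((dL p.2).const_sub (K p.1))).congr_deriv ?_
    have := hφ p hp
    ext i
    simp only [hX, Pi.inv_apply, Pi.add_apply, Pi.smul_apply, Pi.sub_apply, Pi.neg_apply, smul_eq_mul]
    field_simp; ring
  have dN₁ : ∀ p ∈ U, HasDerivAt (fun t => N (t, p.2))
      (g p.2 • ((f p.1 - g p.2)⁻¹ • (K' p.1 - f' p.1 • X p))) p.1 := fun p hp =>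
    ((dX₁ p hp).const_smul (g p.2)).sub_const (L p.2)
  have dN₂ : ∀ p ∈ U, HasDerivAt (fun t => N (p.1, t))
      (f p.1 • ((f p.1 - g p.2)⁻¹ • (g' p.2 • X p - L' p.2))) p.2 := fun p hp => by
    refine (((dg p.2).smul (dX₂ p hp)).sub (dL p.2)).congr_deriv ?_
    have := hφ p hp
    ext i
    simp only [Pi.add_apply, Pi.smul_apply, Pi.sub_apply, smul_eq_mul]
    field_simp; ring
  -- The derivatives of the identities for `K` and `L`.
  have a₁ : ∀ t, 2 * pinner ε (K t) (K' t) = f' t * κ t + f t * κ' t := fun t => by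
    have := ((dK t).pinner (ε := ε) (dK t)).unique
      ((((df t).mul (dκ t)).add_const (ε 2)).congr_of_eventuallyEq (.of_forall KK))
    rw [← this, pinner_comm (K' t)]; ring
  have a₂ : ∀ t, 2 * pinner ε (L t) (L' t) = g' t * ℓ t + g t * ℓ' t := fun t => by
    have := ((dL t).pinner (ε := ε) (dL t)).unique
      ((((dg t).mul (dℓ t)).add_const (ε 2)).congr_of_eventuallyEq (.of_forall LL))
    rw [← this, pinner_comm (L' t)]; ring
  have a₃ : ∀ t u, 2 * pinner ε (K' t) (L u) = f' t * ℓ u + g u * κ' t := fun t u => by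
    have := (((dK t).pinner (ε := ε) (hasDerivAt_const t (L u))).const_mul 2).unique
      (((((df t).mul_const (ℓ u)).add ((dκ t).const_mul (g u))).add_const
        (2 * ε 2)).congr_of_eventuallyEq (.of_forall fun t => KL t u))
    rw [← this]; simp [pinner]
  have a₄ : ∀ t u, 2 * pinner ε (K t) (L' u) = f t * ℓ' u + g' u * κ t := fun t u => by
    have := (((hasDerivAt_const u (K t)).pinner (ε := ε) (dL u)).const_mul 2).unique
      (((((dℓ u).const_mul (f t)).add ((dg u).mul_const (κ t))).add_const
        (2 * ε 2)).congr_of_eventuallyEq (.of_forall fun u => KL t u))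
    rw [← this]; simp [pinner]
  have a₅ : ∀ t u, 2 * pinner ε (K' t) (L' u) = f' t * ℓ' u + g' u * κ' t := fun t u => by
    have := (((hasDerivAt_const u (K' t)).pinner (ε := ε) (dL u)).const_mul 2).unique
      ((((dℓ u).const_mul (f' t)).add ((dg u).mul_const (κ' t))).congr_of_eventuallyEq
        (.of_forall fun u => a₃ t u))
    rw [← this]; simp [pinner]
  -- The frame `φ X,₁ = K' - f' X`, `φ X,₂ = g' X - L'`, `N` has constant scalar products.
  have key : ∀ p ∈ U, pinner ε (K' p.1 - f' p.1 • X p) (K' p.1 - f' p.1 • X p) = ε 0 ∧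
      pinner ε (g' p.2 • X p - L' p.2) (g' p.2 • X p - L' p.2) = ε 1 ∧
      pinner ε (K' p.1 - f' p.1 • X p) (g' p.2 • X p - L' p.2) = 0 ∧
      pinner ε (N p) (K' p.1 - f' p.1 • X p) = 0 ∧
      pinner ε (N p) (g' p.2 • X p - L' p.2) = 0 ∧ pinner ε (N p) (N p) = ε 2 := by
    intro p hp
    have h0 := hφ p hp
    obtain ⟨t, u⟩ := p
    simp only at h0 ⊢
    have r : ∀ z, (f t - g u) * pinner ε (X (t, u)) z = pinner ε (K t) z - pinner ε (L u) z := by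
      intro z
      rw [hX]; simp only [pinner_smul_left, pinner_sub_left]
      rw [mul_inv_cancel_left₀ h0]
    set x := X (t, u)
    obtain ⟨y, hy⟩ : ∃ y, (f t - g u) * y = κ t - ℓ u := ⟨_, mul_div_cancel₀ _ h0⟩
    have xL : 2 * pinner ε x (L u) = ℓ u + g u * y := mul_left_cancel₀ h0 (by
      linear_combination 2 * r (L u) + KL t u - 2 * LL u - g u * hy)
    have xK : 2 * pinner ε x (K t) = κ t + f t * y := mul_left_cancel₀ h0 (by
      linear_combination 2 * r (K t) + 2 * KK t - KL t u - f t * hy -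
        2 * pinner_comm (ε := ε) (L u) (K t))
    have xx : pinner ε x x = y := mul_left_cancel₀ h0 (by
      rw [r x, pinner_comm (K t), pinner_comm (L u)]
      linear_combination (xK - xL) / 2 - hy / 2)
    have xK' : 2 * pinner ε x (K' t) = κ' t + f' t * y := mul_left_cancel₀ h0 (by
      linear_combination 2 * r (K' t) + a₁ t - a₃ t u - f' t * hy -
        2 * pinner_comm (ε := ε) (L u) (K' t))
    have xL' : 2 * pinner ε x (L' u) = ℓ' u + g' u * y := mul_left_cancel₀ h0 (by
      linear_combination 2 * r (L' u) + a₄ t u - a₂ u - g' u * hy)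
    have LK := pinner_comm (ε := ε) (L u) (K' t)
    have K'x := pinner_comm (ε := ε) (K' t) x
    have L'x := pinner_comm (ε := ε) (L' u) x
    have Lx := pinner_comm (ε := ε) (L u) x
    simp only [hN, pinner_sub_left, pinner_sub_right, pinner_smul_left, pinner_smul_right]
    refine ⟨?_, ?_, ?_, ?_, ?_, ?_⟩
    · linear_combination KK' t - f' t * xK' + f' t ^ 2 * xx - f' t * K'x
    · linear_combination LL' u - g' u * xL' + g' u ^ 2 * xx - g' u * L'x
    · linear_combination g' u * xK' / 2 + f' t * xL' / 2 - f' t * g' u * xx - a₅ t u / 2 + g' u * K'x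
    · linear_combination g u * xK' / 2 + f' t * xL / 2 - f' t * g u * xx - a₃ t u / 2 - LK + f' t * Lx
    · linear_combination -g u * xL' / 2 - g' u * xL / 2 + g u * g' u * xx + a₂ u / 2 - g' u * Lx
    · linear_combination g u ^ 2 * xx - g u * xL + LL u - g u * Lx
  refine ⟨X, N, ?_⟩
  have P₁ : ∀ p ∈ U, partial₁ X p = (f p.1 - g p.2)⁻¹ • (K' p.1 - f' p.1 • X p) :=
    fun p hp => (dX₁ p hp).deriv
  have P₂ : ∀ p ∈ U, partial₂ X p = (f p.1 - g p.2)⁻¹ • (g' p.2 • X p - L' p.2) :=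
    fun p hp => (dX₂ p hp).deriv
  have G₁₁ : ∀ p ∈ U, pinner ε (partial₁ X p) (partial₁ X p) = 1 / (f p.1 - g p.2) ^ 2 * ε 0 :=
    fun p hp => by
      rw [P₁ p hp, pinner_smul_left, pinner_smul_right, (key p hp).1]; field_simp
  have G₂₂ : ∀ p ∈ U, pinner ε (partial₂ X p) (partial₂ X p) = 1 / (f p.1 - g p.2) ^ 2 * ε 1 :=
    fun p hp => by
      rw [P₂ p hp, pinner_smul_left, pinner_smul_right, (key p hp).2.1]; field_simp
  have G₁₂ : ∀ p ∈ U, pinner ε (partial₁ X p) (partial₂ X p) = 0 := fun p hp => by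
    rw [P₁ p hp, P₂ p hp, pinner_smul_left, pinner_smul_right, (key p hp).2.2.1]; ring
  have ρ0 : ∀ p ∈ U, 1 / (f p.1 - g p.2) ^ 2 ≠ 0 := fun p hp =>
    one_div_ne_zero (pow_ne_zero 2 (hφ p hp))
  exact {
    smooth := sX
    smooth_normal := sN
    immersion := fun p hp => linearIndependent_pair_of_pinner
      (by rw [G₁₁ p hp]; exact mul_ne_zero (ρ0 p hp) (hε 0))
      (by rw [G₂₂ p hp]; exact mul_ne_zero (ρ0 p hp) (hε 1)) (G₁₂ p hp)
    normal₁ := fun p hp => by rw [P₁ p hp, pinner_smul_right, (key p hp).2.2.2.1, mul_zero]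
    normal₂ := fun p hp => by rw [P₂ p hp, pinner_smul_right, (key p hp).2.2.2.2.1, mul_zero]
    unit := fun p hp => (key p hp).2.2.2.2.2
    orthogonal := G₁₂
    rodrigues₁ := fun p hp => by rw [P₁ p hp, h₁ p hp]; exact (dN₁ p hp).deriv
    rodrigues₂ := fun p hp => by rw [P₂ p hp, h₂ p hp]; exact (dN₂ p hp).deriv
    distinct := hne
    dupin₁ := fun p hp => (hasDerivAt_const p.1 (g p.2)).congr_of_eventuallyEq
      ((eventually_mem_fst hU hp).mono fun t ht => h₁ _ ht)
    dupin₂ := fun p hp => (hasDerivAt_const p.2 (f p.1)).congr_of_eventuallyEq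
      ((eventually_mem_snd hU hp).mono fun t ht => h₂ _ ht)
    isothermic := fun p hp => by
      beta_reduce; rw [h₁ p hp, h₂ p hp]; exact ⟨G₁₁ p hp, G₁₂ p hp, G₂₂ p hp⟩ }

section Existence

/-- The Gauss equation at one point in the form of the three relations needed between the initial
second derivatives of the curvature spheres; `v` is the inverse of `l₂ - l₁`. -/
theorem gauss_cross {e₁ e₂ e₃ b C l₁ l₂ m₁ m₂ v : ℝ} (h₁ : e₁ ^ 2 = 1) (h₂ : e₂ ^ 2 = 1)
    (hv : v * (l₂ - l₁) = 1)
    (hG : (l₂ - l₁) * (b * l₂ + (1 + b) * l₁ + 2 * C) - e₃ * e₁ * m₂ ^ 2 - e₃ * e₂ * m₁ ^ 2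
      - l₁ * l₂ = 0) (h₃ : e₃ ^ 2 = 1) :
    e₁ * (e₃ * e₁ * b) + v ^ 2 * (e₁ * m₂ ^ 2 + e₂ * m₁ ^ 2 + e₃ * l₁ ^ 2) =
        2 * e₁ * v * (e₃ * e₁ * b * l₂ + e₃ * e₁ * C) ∧
      e₂ * (-(e₃ * e₂) * (1 + b)) + v ^ 2 * (e₁ * m₂ ^ 2 + e₂ * m₁ ^ 2 + e₃ * l₂ ^ 2) =
        -(2 * e₂ * v * (-(e₃ * e₂) * (1 + b) * l₁ + -(e₃ * e₂) * C)) ∧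
      v ^ 2 * (e₂ * m₂ ^ 2 + e₁ * m₁ ^ 2 + e₁ * e₂ * e₃ * (l₁ * l₂)) =
        v * (e₂ * (e₃ * e₁ * b * l₂ + e₃ * e₁ * C)
          - e₁ * (-(e₃ * e₂) * (1 + b) * l₁ + -(e₃ * e₂) * C)) := by
  have hφ : l₂ - l₁ ≠ 0 := right_ne_zero_of_mul_eq_one hv
  obtain rfl : v = (l₂ - l₁)⁻¹ := eq_inv_of_mul_eq_one_left hv
  refine ⟨?_, ?_, ?_⟩
  · field_simp
    linear_combination -e₃ * hG - (e₁ * m₂ ^ 2 + e₂ * m₁ ^ 2) * h₃ +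
      (e₃ * b * (l₂ - l₁) ^ 2 - 2 * e₃ * (l₂ - l₁) * (b * l₂ + C)) * h₁
  · field_simp
    linear_combination -e₃ * hG - (e₁ * m₂ ^ 2 + e₂ * m₁ ^ 2) * h₃ -
      (e₃ * (1 + b) * (l₂ - l₁) ^ 2 + 2 * e₃ * (l₂ - l₁) * ((1 + b) * l₁ + C)) * h₂
  · field_simp
    linear_combination -(e₁ * e₂ * e₃) * hG - e₂ * m₂ ^ 2 * (e₁ ^ 2 * h₃ + h₁) -
      e₁ * m₁ ^ 2 * (e₂ ^ 2 * h₃ + h₂)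

/-- The curvature spheres are the solutions of linear equations with the constant coefficients of
the equations for `l₂` and `l₁`; their initial values at a point `p₀` of `U` are those of the
surface with `X = 0`, with normal `(0, 0, 1)` and with the principal directions `(1, 0, 0)`,
`(0, 1, 0)` at `p₀`. They are defined on all of `ℝ`, so that no simple connectedness is needed. -/
theorem IsDupinSolution.exists_isIsothermicDupin {ε : Fin 3 → ℝ} (hε : ∀ i, ε i ^ 2 = 1)
    {U : Set (ℝ × ℝ)} (hU : IsOpen U) (hUc : IsConnected U) {b C : ℝ} {l₁ l₂ m₁ m₂ : ℝ × ℝ → ℝ}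
    (H : IsDupinSolution (ε 2 * ε 0) (ε 2 * ε 1) b C U l₁ l₂ m₁ m₂)
    (hne : ∀ p ∈ U, l₁ p ≠ l₂ p) : ∃ X N : ℝ × ℝ → E3, IsIsothermicDupin ε U X N l₁ l₂ := by
  obtain ⟨p₀, hp₀⟩ := hUc.nonempty
  have hUc' : IsConnected (Prod.swap ⁻¹' U) := by
    rw [← Set.image_swap_eq_preimage_swap]
    exact hUc.image _ continuous_swap.continuousOn
  obtain ⟨s, d, cs, cd, hd, hs, s0, d0⟩ := exists_fundamental_solution (ε 2 * ε 0 * b) p₀.1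
  obtain ⟨r, q, cr, cq, hq, hr, r0, q0⟩ :=
    exists_fundamental_solution (-(ε 2 * ε 1) * (1 + b)) p₀.2
  have e₂ := H.partials_l₂.eq_fundamental hU hUc hp₀ H.partials_m₂ hd hs s0 d0
  have e₁ := fun p (hp : p ∈ U) => H.partials_l₁.swap.eq_fundamental (p₀ := p₀.swap)
    (hU.preimage continuous_swap) hUc' hp₀ H.partials_m₁.swap hq hr r0 q0 p.swap hp
  simp only [Function.comp_apply, Prod.swap_swap, Prod.fst_swap] at e₁
  obtain ⟨v, hv⟩ : ∃ v, v * (l₂ p₀ - l₁ p₀) = 1 :=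
    ⟨_, inv_mul_cancel₀ (sub_ne_zero.2 (hne p₀ hp₀).symm)⟩
  obtain ⟨g₁, g₂, g₃⟩ := gauss_cross (hε 0) (hε 1) hv (H.gauss p₀ hp₀) (hε 2)
  have sq₂ := fundamental_sq hd hs s0 d0
  have sq₁ := fundamental_sq hq hr r0 q0
  have h0 := hε 0
  have h1 := hε 1
  have h2 := hε 2
  set n₂ := ε 2 * ε 0 * b * l₂ p₀ + ε 2 * ε 0 * C
  set n₁ := -(ε 2 * ε 1) * (1 + b) * l₁ p₀ + -(ε 2 * ε 1) * C
  set β₂ := ε 2 * ε 0 * b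
  set β₁ := -(ε 2 * ε 1) * (1 + b)
  generalize l₂ p₀ = L₂ at *
  generalize l₁ p₀ = L₁ at *
  generalize m₂ p₀ = M₂ at *
  generalize m₁ p₀ = M₁ at *
  have hvec : ∀ {a₀ a₁ a₂ a₀' a₁' a₂' : ℝ → ℝ}, (∀ t, HasDerivAt a₀ (a₀' t) t) →
      (∀ t, HasDerivAt a₁ (a₁' t) t) → (∀ t, HasDerivAt a₂ (a₂' t) t) →
      ∀ t, HasDerivAt (fun t => (![a₀ t, a₁ t, a₂ t] : E3)) ![a₀' t, a₁' t, a₂' t] t := by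
    intro a₀ a₁ a₂ a₀' a₁' a₂' h h' h'' t
    rw [hasDerivAt_pi]
    intro i
    fin_cases i
    exacts [h t, h' t, h'' t]
  have cvec : ∀ {a₀ a₁ a₂ : ℝ → ℝ}, ContDiff ℝ ∞ a₀ → ContDiff ℝ ∞ a₁ → ContDiff ℝ ∞ a₂ →
      ContDiff ℝ ∞ (fun t => (![a₀ t, a₁ t, a₂ t] : E3)) := by
    intro a₀ a₁ a₂ h h' h''
    rw [contDiff_pi]
    intro i
    fin_cases i
    exacts [h, h', h'']
  refine isIsothermicDupin_of_curvature_spheres (fun i hi => by simpa [hi] using hε i) hU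
    (K := fun t => ![s t + d t * (M₂ * v), d t * (-(ε 0 * ε 1) * M₁ * v),
      -1 + d t * (-(ε 2 * ε 0) * L₁ * v)])
    (L := fun t => ![q t * (-(ε 0 * ε 1) * M₂ * v), -r t + q t * (M₁ * v),
      -1 + q t * (ε 2 * ε 1 * L₂ * v)])
    (κ := fun t => d t * (2 * ε 0 * v)) (ℓ := fun t => q t * (-(2 * ε 1) * v))
    (f := fun t => L₂ + s t * M₂ + d t * n₂) (g := fun t => L₁ + r t * M₁ + q t * n₁)
    (cvec (by fun_prop) (by fun_prop) (by fun_prop))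
    (cvec (by fun_prop) (by fun_prop) (by fun_prop)) (by fun_prop) (by fun_prop)
    (hvec (fun t => (hs t).add ((hd t).mul_const _)) (fun t => (hd t).mul_const _)
      fun t => ((hd t).mul_const _).const_add _)
    (hvec (fun t => (hq t).mul_const _) (fun t => (hr t).neg.add ((hq t).mul_const _))
      fun t => ((hq t).mul_const _).const_add _)
    (fun t => (hd t).mul_const _) (fun t => (hq t).mul_const _)
    (fun t => (((hs t).mul_const _).const_add _).add ((hd t).mul_const _))
    (fun t => (((hr t).mul_const _).const_add _).add ((hq t).mul_const _))
    (fun t => ?_) (fun t => ?_) (fun t u => ?_) (fun t => ?_) (fun t => ?_) e₁ e₂ hne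
  all_goals simp only [pinner, Matrix.cons_val]
  · linear_combination ε 0 * sq₂ t + d t ^ 2 * g₁ - 2 * ε 0 * d t * hv +
      ε 1 * M₁ ^ 2 * v ^ 2 * d t ^ 2 * (ε 1 ^ 2 * h0 + h1) + 2 * d t * ε 0 * L₁ * v * h2 +
      ε 2 * d t ^ 2 * L₁ ^ 2 * v ^ 2 * (ε 0 ^ 2 * h2 + h0)
  · linear_combination ε 1 * sq₁ t + q t ^ 2 * g₂ - 2 * ε 1 * q t * hv +
      ε 0 * M₂ ^ 2 * v ^ 2 * q t ^ 2 * (ε 1 ^ 2 * h0 + h1) - 2 * q t * ε 1 * L₂ * v * h2 +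
      ε 2 * q t ^ 2 * L₂ ^ 2 * v ^ 2 * (ε 1 ^ 2 * h2 + h1)
  · linear_combination -2 * d t * q u * g₃ -
      2 * ε 1 * q u * M₂ * v * (s t + d t * M₂ * v) * h0 +
      2 * ε 0 * d t * M₁ * v * (r u - q u * M₁ * v) * h1 +
      (-2 * q u * ε 1 * L₂ * v + 2 * d t * ε 0 * L₁ * v -
        2 * d t * q u * ε 2 * ε 0 * ε 1 * L₁ * L₂ * v ^ 2) * h2
  · linear_combination s t ^ 2 * g₁ - ε 0 * β₂ * sq₂ t +
      ε 1 * M₁ ^ 2 * v ^ 2 * s t ^ 2 * (ε 1 ^ 2 * h0 + h1) +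
      ε 2 * s t ^ 2 * L₁ ^ 2 * v ^ 2 * (ε 0 ^ 2 * h2 + h0)
  · linear_combination r t ^ 2 * g₂ - ε 1 * β₁ * sq₁ t +
      ε 0 * M₂ ^ 2 * v ^ 2 * r t ^ 2 * (ε 1 ^ 2 * h0 + h1) +
      ε 2 * r t ^ 2 * L₂ ^ 2 * v ^ 2 * (ε 1 ^ 2 * h2 + h1)

end Existence

/-! ### Partial derivatives of smooth functions -/

section Partials
variable {F : Type*} [NormedAddCommGroup F] [NormedSpace ℝ F] {U : Set (ℝ × ℝ)}

theorem HasPartials.unique {f f' g h g' h' : ℝ × ℝ → F} (hU : IsOpen U) (H : HasPartials U f g h)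
    (H' : HasPartials U f' g' h') (hf : ∀ p ∈ U, f' p = f p) :
    ∀ p ∈ U, g p = g' p ∧ h p = h' p := fun p hp =>
  have K := H.congr_fun hU hf
  ⟨(K p hp).1.unique (H' p hp).1, (K p hp).2.unique (H' p hp).2⟩

theorem HasPartials.smul {f g h : ℝ × ℝ → ℝ} {f' g' h' : ℝ × ℝ → F} (H : HasPartials U f g h)
    (H' : HasPartials U f' g' h') :
    HasPartials U (fun p => f p • f' p) (fun p => f p • g' p + g p • f' p)
      (fun p => f p • h' p + h p • f' p) :=
  fun p hp => ⟨(H p hp).1.smul (H' p hp).1, (H p hp).2.smul (H' p hp).2⟩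

theorem HasPartials.inv {f g h : ℝ × ℝ → ℝ} (H : HasPartials U f g h) (h0 : ∀ p ∈ U, f p ≠ 0) :
    HasPartials U (fun p => (f p)⁻¹) (fun p => -g p / f p ^ 2) (fun p => -h p / f p ^ 2) :=
  fun p hp => ⟨(H p hp).1.inv (h0 p hp), (H p hp).2.inv (h0 p hp)⟩

theorem HasPartials.pinner {ε : Fin 3 → ℝ} {f g h f' g' h' : ℝ × ℝ → E3}
    (H : HasPartials U f g h) (H' : HasPartials U f' g' h') :
    HasPartials U (fun p => pinner ε (f p) (f' p))
      (fun p => pinner ε (g p) (f' p) + pinner ε (f p) (g' p))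
      (fun p => pinner ε (h p) (f' p) + pinner ε (f p) (h' p)) :=
  fun p hp => ⟨(H p hp).1.pinner (H' p hp).1, (H p hp).2.pinner (H' p hp).2⟩

/-- Partial derivatives up to second order; the mixed ones agree. -/
theorem exists_partials_of_contDiffOn (hU : IsOpen U) {f : ℝ × ℝ → F} (hf : ContDiffOn ℝ ∞ f U) :
    ∃ f₁ f₂, ContDiffOn ℝ ∞ f₁ U ∧ ContDiffOn ℝ ∞ f₂ U ∧ HasPartials U f f₁ f₂ ∧
      ∃ f₁₁ f₁₂ f₂₂, HasPartials U f₁ f₁₁ f₁₂ ∧ HasPartials U f₂ f₁₂ f₂₂ := by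
  have step : ∀ {g : ℝ × ℝ → F}, ContDiffOn ℝ ∞ g U →
      ContDiffOn ℝ ∞ (fun p => fderiv ℝ g p (1, 0)) U ∧
      ContDiffOn ℝ ∞ (fun p => fderiv ℝ g p (0, 1)) U ∧
      HasPartials U g (fun p => fderiv ℝ g p (1, 0)) (fun p => fderiv ℝ g p (0, 1)) := by
    intro g hg
    have hg' : ContDiffOn ℝ ∞ (fderiv ℝ g) U := hg.fderiv_of_isOpen hU (by simp)
    refine ⟨hg'.clm_apply contDiffOn_const, hg'.clm_apply contDiffOn_const, fun p hp => ?_⟩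
    have hd : HasFDerivAt g (fderiv ℝ g p) (p.1, p.2) :=
      ((hg.contDiffAt (hU.mem_nhds hp)).differentiableAt (by simp)).hasFDerivAt
    exact ⟨hd.comp_hasDerivAt p.1 ((hasDerivAt_id p.1).prodMk (hasDerivAt_const p.1 p.2)),
      hd.comp_hasDerivAt p.2 ((hasDerivAt_const p.2 p.1).prodMk (hasDerivAt_id p.2))⟩
  obtain ⟨c₁, c₂, P⟩ := step hf
  obtain ⟨-, -, P₁⟩ := step c₁
  obtain ⟨-, -, P₂⟩ := step c₂
  refine ⟨_, _, c₁, c₂, P, _, _, _, P₁, P₂.congr (fun p hp => ?_) fun _ _ => rfl⟩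
  have hp' := hU.mem_nhds hp
  have hdd : DifferentiableAt ℝ (fderiv ℝ f) p :=
    ((hf.fderiv_of_isOpen hU (m := ∞) (by simp)).contDiffAt hp').differentiableAt (by simp)
  have hs : IsSymmSndFDerivAt ℝ f p := (hf.contDiffAt hp').isSymmSndFDerivAt (by
    rw [minSmoothness_of_isRCLikeNormedField]; exact WithTop.coe_le_coe.2 (le_top (a := (2 : ℕ∞))))
  rw [fderiv_clm_apply hdd (differentiableAt_const _),
    fderiv_clm_apply hdd (differentiableAt_const _)]
  simpa using hs.eq (1, 0) (0, 1)

/-- If `f` does not depend locally on the first variable, then neither does its derivative in the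
second one. -/
theorem exists_partial_snd {f : ℝ × ℝ → F} (hU : IsOpen U) (hf : ContDiffOn ℝ ∞ f U)
    (h : ∀ p ∈ U, HasDerivAt (fun t => f (t, p.2)) 0 p.1) :
    ∃ m, ContDiffOn ℝ ∞ m U ∧ HasPartials U f (fun _ => 0) m ∧
      ∀ p ∈ U, HasDerivAt (fun t => m (t, p.2)) 0 p.1 := by
  obtain ⟨f₁, f₂, c₁, c₂, P, f₁₁, f₁₂, f₂₂, P₁, P₂⟩ := exists_partials_of_contDiffOn hU hf
  have e : ∀ p ∈ U, f₁ p = 0 := fun p hp => (P p hp).1.unique (h p hp)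
  refine ⟨f₂, c₂, P.congr e fun _ _ => rfl, fun p hp => ?_⟩
  have := (P₁.unique hU (.const 0) fun p hp => (e p hp).symm) p hp
  exact this.2 ▸ (P₂ p hp).1

theorem exists_partial_fst {f : ℝ × ℝ → F} (hU : IsOpen U) (hf : ContDiffOn ℝ ∞ f U)
    (h : ∀ p ∈ U, HasDerivAt (fun t => f (p.1, t)) 0 p.2) :
    ∃ m, ContDiffOn ℝ ∞ m U ∧ HasPartials U f m (fun _ => 0) ∧
      ∀ p ∈ U, HasDerivAt (fun t => m (p.1, t)) 0 p.2 := by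
  have sw : ∀ {g : ℝ × ℝ → F} {V : Set (ℝ × ℝ)}, ContDiffOn ℝ ∞ g V →
      ContDiffOn ℝ ∞ (g ∘ Prod.swap) (Prod.swap ⁻¹' V) := fun hg =>
    hg.comp (contDiff_snd.prodMk contDiff_fst).contDiffOn fun _ hx => hx
  obtain ⟨m, c, P, Q⟩ := exists_partial_snd (hU.preimage continuous_swap) (sw hf)
    fun p hp => h p.swap hp
  exact ⟨m ∘ Prod.swap, sw c, P.swap, fun p hp => Q p.swap hp⟩

theorem ContDiffOn.pinner {ε : Fin 3 → ℝ} {f g : ℝ × ℝ → E3} (hf : ContDiffOn ℝ ∞ f U)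
    (hg : ContDiffOn ℝ ∞ g U) : ContDiffOn ℝ ∞ (fun p => pinner ε (f p) (g p)) U := by
  have h := contDiffOn_pi.1 hf
  have h' := contDiffOn_pi.1 hg
  exact (((contDiffOn_const.mul (h 0)).mul (h' 0)).add ((contDiffOn_const.mul (h 1)).mul (h' 1))).add
    ((contDiffOn_const.mul (h 2)).mul (h' 2))

end Partials

/-! ### The Gauss equation of an isothermic Dupin surface -/

/-- Expansion of the product in a frame that is orthonormal with the signs `ε`. -/
theorem pinner_eq_of_frame {ε : Fin 3 → ℝ} (hε : ∀ i, ε i ^ 2 = 1) {e₁ e₂ e₃ : E3}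
    (h₁₁ : pinner ε e₁ e₁ = ε 0) (h₂₂ : pinner ε e₂ e₂ = ε 1) (h₃₃ : pinner ε e₃ e₃ = ε 2)
    (h₁₂ : pinner ε e₁ e₂ = 0) (h₁₃ : pinner ε e₁ e₃ = 0) (h₂₃ : pinner ε e₂ e₃ = 0) (v w : E3) :
    pinner ε v w = ε 0 * pinner ε v e₁ * pinner ε w e₁ + ε 1 * pinner ε v e₂ * pinner ε w e₂ +
      ε 2 * pinner ε v e₃ * pinner ε w e₃ := by
  set A : Matrix (Fin 3) (Fin 3) ℝ := Matrix.of ![e₁, e₂, e₃]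
  have hA : A * (Matrix.diagonal ε * A.transpose * Matrix.diagonal ε) = 1 := by
    have h₂₁ := (pinner_comm e₂ e₁).trans h₁₂
    have h₃₁ := (pinner_comm e₃ e₁).trans h₁₃
    have h₃₂ := (pinner_comm e₃ e₂).trans h₂₃
    simp only [pinner] at h₁₁ h₂₂ h₃₃ h₁₂ h₁₃ h₂₃ h₂₁ h₃₁ h₃₂
    ext i j
    fin_cases i <;> fin_cases j <;>
      simp [A, Matrix.mul_apply, Fin.sum_univ_three]
    · linear_combination ε 0 * h₁₁ + hε 0
    · linear_combination ε 1 * h₁₂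
    · linear_combination ε 2 * h₁₃
    · linear_combination ε 0 * h₂₁
    · linear_combination ε 1 * h₂₂ + hε 1
    · linear_combination ε 2 * h₂₃
    · linear_combination ε 0 * h₃₁
    · linear_combination ε 1 * h₃₂
    · linear_combination ε 2 * h₃₃ + hε 2
  have hA' : ∀ i j, (Matrix.diagonal ε * A.transpose * Matrix.diagonal ε * A) i j =
      (1 : Matrix (Fin 3) (Fin 3) ℝ) i j := fun i j => by rw [mul_eq_one_comm.1 hA]
  have q₀₀ := hA' 0 0
  have q₀₁ := hA' 0 1
  have q₀₂ := hA' 0 2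
  have q₁₀ := hA' 1 0
  have q₁₁ := hA' 1 1
  have q₁₂ := hA' 1 2
  have q₂₀ := hA' 2 0
  have q₂₁ := hA' 2 1
  have q₂₂ := hA' 2 2
  simp [A, Matrix.mul_apply, Fin.sum_univ_three]
    at q₀₀ q₀₁ q₀₂ q₁₀ q₁₁ q₁₂ q₂₀ q₂₁ q₂₂
  simp only [pinner]
  linear_combination -(v 0 * ε 0 * w 0 * q₀₀ + v 0 * ε 1 * w 1 * q₀₁ + v 0 * ε 2 * w 2 * q₀₂ +
    v 1 * ε 0 * w 0 * q₁₀ + v 1 * ε 1 * w 1 * q₁₁ + v 1 * ε 2 * w 2 * q₁₂ +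
    v 2 * ε 0 * w 0 * q₂₀ + v 2 * ε 1 * w 1 * q₂₁ + v 2 * ε 2 * w 2 * q₂₂)

section Gauss
variable {ε : Fin 3 → ℝ} {U : Set (ℝ × ℝ)} {X N : ℝ × ℝ → E3} {l₁ l₂ : ℝ × ℝ → ℝ}

/-- The principal curvatures are smooth, as quotients of products of smooth vector fields. -/
theorem IsIsothermicDupin.contDiffOn (hε : ∀ i, ε i ≠ 0) (hU : IsOpen U)
    (H : IsIsothermicDupin ε U X N l₁ l₂) : ContDiffOn ℝ ∞ l₁ U ∧ ContDiffOn ℝ ∞ l₂ U := by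
  obtain ⟨X₁, X₂, cX₁, cX₂, PX, -⟩ := exists_partials_of_contDiffOn hU H.smooth
  obtain ⟨N₁, N₂, cN₁, cN₂, PN, -⟩ := exists_partials_of_contDiffOn hU H.smooth_normal
  have ρ0 : ∀ p ∈ U, 1 / (l₂ p - l₁ p) ^ 2 ≠ 0 := fun p hp =>
    one_div_ne_zero (pow_ne_zero 2 (sub_ne_zero.2 (H.distinct p hp).symm))
  have eX₁ : ∀ p ∈ U, partial₁ X p = X₁ p := fun p hp => (PX p hp).1.deriv
  have eX₂ : ∀ p ∈ U, partial₂ X p = X₂ p := fun p hp => (PX p hp).2.deriv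
  have eN₁ : ∀ p ∈ U, partial₁ N p = N₁ p := fun p hp => (PN p hp).1.deriv
  have eN₂ : ∀ p ∈ U, partial₂ N p = N₂ p := fun p hp => (PN p hp).2.deriv
  have h₁ : ∀ p ∈ U, pinner ε (X₁ p) (X₁ p) ≠ 0 := fun p hp => by
    rw [← eX₁ p hp, (H.isothermic p hp).1]; exact mul_ne_zero (ρ0 p hp) (hε 0)
  have h₂ : ∀ p ∈ U, pinner ε (X₂ p) (X₂ p) ≠ 0 := fun p hp => by
    rw [← eX₂ p hp, (H.isothermic p hp).2.2]; exact mul_ne_zero (ρ0 p hp) (hε 1)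
  constructor
  · refine ((cN₁.pinner (ε := ε) cX₁).div (cX₁.pinner cX₁) h₁).congr fun p hp => ?_
    rw [Pi.div_apply, eq_div_iff (h₁ p hp), ← eN₁ p hp, H.rodrigues₁ p hp, pinner_smul_left, eX₁ p hp]
  · refine ((cN₂.pinner (ε := ε) cX₂).div (cX₂.pinner cX₂) h₂).congr fun p hp => ?_
    rw [Pi.div_apply, eq_div_iff (h₂ p hp), ← eN₂ p hp, H.rodrigues₂ p hp, pinner_smul_left, eX₂ p hp]

/-- The Gauss equation. The frame `e₁ = φ X,₁`, `e₂ = φ X,₂`, `N` with `φ = l₂ - l₁` satisfies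
`e₁,₂ = -(m₂ / φ) e₂` and `e₂,₁ = (m₁ / φ) e₁` by the Codazzi equation; the mixed derivatives of
`⟨e₁,₁, e₂⟩` and `⟨e₁,₂, e₂⟩` are compared. -/
theorem IsIsothermicDupin.gauss (hε : ∀ i, ε i ^ 2 = 1) (hU : IsOpen U)
    (H : IsIsothermicDupin ε U X N l₁ l₂) {m₁ m₂ n₁ n₂ : ℝ × ℝ → ℝ}
    (P₁ : HasPartials U l₁ (fun _ => 0) m₁) (P₁' : HasPartials U m₁ (fun _ => 0) n₁)
    (P₂ : HasPartials U l₂ m₂ (fun _ => 0)) (P₂' : HasPartials U m₂ n₂ (fun _ => 0)) :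
    ∀ p ∈ U, (l₂ p - l₁ p) * (ε 2 * ε 0 * n₂ p - ε 2 * ε 1 * n₁ p) - ε 2 * ε 0 * m₂ p ^ 2
      - ε 2 * ε 1 * m₁ p ^ 2 - l₁ p * l₂ p = 0 := by
  obtain ⟨X₁, X₂, cX₁, cX₂, PX, X₁₁, X₁₂, X₂₂, PX₁, PX₂⟩ :=
    exists_partials_of_contDiffOn hU H.smooth
  obtain ⟨N₁, N₂, -, -, PN, N₁₁, N₁₂, N₂₂, PN₁, PN₂⟩ :=
    exists_partials_of_contDiffOn hU H.smooth_normal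
  obtain ⟨cl₁, cl₂⟩ := H.contDiffOn (fun i hi => by simpa [hi] using hε i) hU
  have eX₁ : ∀ p ∈ U, partial₁ X p = X₁ p := fun p hp => (PX p hp).1.deriv
  have eX₂ : ∀ p ∈ U, partial₂ X p = X₂ p := fun p hp => (PX p hp).2.deriv
  have eN₁ : ∀ p ∈ U, N₁ p = l₁ p • X₁ p := fun p hp => by
    rw [← eX₁ p hp, ← H.rodrigues₁ p hp]; exact (PN p hp).1.deriv.symm
  have eN₂ : ∀ p ∈ U, N₂ p = l₂ p • X₂ p := fun p hp => by
    rw [← eX₂ p hp, ← H.rodrigues₂ p hp]; exact (PN p hp).2.deriv.symm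
  have hφ : ∀ p ∈ U, l₂ p - l₁ p ≠ 0 := fun p hp => sub_ne_zero.2 (H.distinct p hp).symm
  have codazzi : ∀ p ∈ U, (l₂ p - l₁ p) • X₁₂ p = m₁ p • X₁ p - m₂ p • X₂ p := fun p hp => by
    have a := (((P₁.smul PX₁).unique hU PN₁ eN₁) p hp).2
    have b := (((P₂.smul PX₂).unique hU PN₂ eN₂) p hp).1
    rw [← b] at a
    rw [sub_smul, sub_eq_sub_iff_add_eq_add, add_comm (m₁ p • X₁ p), a]
  obtain ⟨E, hE⟩ : ∃ E : ℝ × ℝ → E3, E = fun p => (l₂ p - l₁ p) • X₁ p := ⟨_, rfl⟩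
  obtain ⟨G, hG⟩ : ∃ G : ℝ × ℝ → E3, G = fun p => (l₂ p - l₁ p) • X₂ p := ⟨_, rfl⟩
  obtain ⟨E₁, E₂, -, -, PE, E₁₁, E₁₂, E₂₂, PE₁, PE₂⟩ :=
    exists_partials_of_contDiffOn (f := E) hU (hE ▸ (cl₂.sub cl₁).smul cX₁)
  obtain ⟨G₁, G₂, -, -, PG, -⟩ :=
    exists_partials_of_contDiffOn (f := G) hU (hG ▸ (cl₂.sub cl₁).smul cX₂)
  have XE : ∀ p ∈ U, X₁ p = (l₂ p - l₁ p)⁻¹ • E p := fun p hp => by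
    rw [hE]; exact (inv_smul_smul₀ (hφ p hp) _).symm
  have XG : ∀ p ∈ U, X₂ p = (l₂ p - l₁ p)⁻¹ • G p := fun p hp => by
    rw [hG]; exact (inv_smul_smul₀ (hφ p hp) _).symm
  have eE₂ : ∀ p ∈ U, E₂ p = (-m₂ p * (l₂ p - l₁ p)⁻¹) • G p := fun p hp => by
    rw [((PE.unique hU ((P₂.sub P₁).smul PX₁) fun p _ => by rw [hE]) p hp).2, codazzi p hp,
      mul_smul, ← XG p hp, zero_sub, neg_smul, neg_smul]
    abel
  have eG₁ : ∀ p ∈ U, G₁ p = (m₁ p * (l₂ p - l₁ p)⁻¹) • E p := fun p hp => by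
    rw [((PG.unique hU ((P₂.sub P₁).smul PX₂) fun p _ => by rw [hG]) p hp).1, codazzi p hp,
      mul_smul, ← XE p hp, sub_zero]
    abel
  have EE : ∀ p ∈ U, pinner ε (E p) (E p) = ε 0 := fun p hp => by
    have := (H.isothermic p hp).1
    rw [eX₁ p hp] at this
    rw [hE]; simp only [pinner_smul_left, pinner_smul_right]
    rw [this]; have := hφ p hp; field_simp
  have GG : ∀ p ∈ U, pinner ε (G p) (G p) = ε 1 := fun p hp => by
    have := (H.isothermic p hp).2.2
    rw [eX₂ p hp] at this
    rw [hG]; simp only [pinner_smul_left, pinner_smul_right]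
    rw [this]; have := hφ p hp; field_simp
  have EG : ∀ p ∈ U, pinner ε (E p) (G p) = 0 := fun p hp => by
    have := H.orthogonal p hp
    rw [eX₁ p hp, eX₂ p hp] at this
    rw [hE, hG]; simp only [pinner_smul_left, pinner_smul_right]
    rw [this]; ring
  have EN : ∀ p ∈ U, pinner ε (E p) (N p) = 0 := fun p hp => by
    have := H.normal₁ p hp
    rw [eX₁ p hp] at this
    rw [pinner_comm, hE, pinner_smul_right, this, mul_zero]
  have GN : ∀ p ∈ U, pinner ε (G p) (N p) = 0 := fun p hp => by
    have := H.normal₂ p hp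
    rw [eX₂ p hp] at this
    rw [pinner_comm, hG, pinner_smul_right, this, mul_zero]
  -- First derivatives of the orthonormality relations.
  have E₁E : ∀ p ∈ U, pinner ε (E₁ p) (E p) = 0 := fun p hp => by
    have := (((PE.pinner (ε := ε) PE).unique hU (.const (ε 0)) fun p hp => (EE p hp).symm) p hp).1
    rw [pinner_comm (E p)] at this
    linarith
  have G₂G : ∀ p ∈ U, pinner ε (G₂ p) (G p) = 0 := fun p hp => by
    have := (((PG.pinner (ε := ε) PG).unique hU (.const (ε 1)) fun p hp => (GG p hp).symm) p hp).2
    rw [pinner_comm (G p)] at this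
    linarith
  have E₁N : ∀ p ∈ U, pinner ε (E₁ p) (N p) = -(l₁ p * (l₂ p - l₁ p)⁻¹ * ε 0) := fun p hp => by
    have := (((PE.pinner (ε := ε) PN).unique hU (.const 0) fun p hp => (EN p hp).symm) p hp).1
    rw [eN₁ p hp, XE p hp, pinner_smul_right, pinner_smul_right, EE p hp] at this
    linear_combination this
  have G₂N : ∀ p ∈ U, pinner ε (G₂ p) (N p) = -(l₂ p * (l₂ p - l₁ p)⁻¹ * ε 1) := fun p hp => by
    have := (((PG.pinner (ε := ε) PN).unique hU (.const 0) fun p hp => (GN p hp).symm) p hp).2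
    rw [eN₂ p hp, XG p hp, pinner_smul_right, pinner_smul_right, GG p hp] at this
    linear_combination this
  have E₁G : ∀ p ∈ U, pinner ε (E₁ p) (G p) = -ε 0 * (m₁ p * (l₂ p - l₁ p)⁻¹) := fun p hp => by
    have := (((PE.pinner (ε := ε) PG).unique hU (.const 0) fun p hp => (EG p hp).symm) p hp).1
    rw [eG₁ p hp, pinner_smul_right, EE p hp] at this
    linear_combination this
  have E₂G : ∀ p ∈ U, pinner ε (E₂ p) (G p) = -ε 1 * (m₂ p * (l₂ p - l₁ p)⁻¹) := fun p hp => by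
    rw [eE₂ p hp, pinner_smul_left, GG p hp]; ring
  intro p hp
  have Pφ := (P₂.sub P₁).inv hφ
  have A := (((PE₁.pinner (ε := ε) PG).unique hU ((P₁'.mul Pφ).const_mul (-ε 0))
    fun p hp => (E₁G p hp).symm) p hp).2
  have B := (((PE₂.pinner (ε := ε) PG).unique hU ((P₂'.mul Pφ).const_mul (-ε 1))
    fun p hp => (E₂G p hp).symm) p hp).1
  have GE : pinner ε (G p) (E p) = 0 := (pinner_comm _ _).trans (EG p hp)
  rw [pinner_eq_of_frame hε (EE p hp) (GG p hp) (H.unit p hp) (EG p hp) (EN p hp) (GN p hp)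
    (E₁ p) (G₂ p), E₁E p hp, G₂G p hp, E₁N p hp, G₂N p hp] at A
  rw [eE₂ p hp, eG₁ p hp, pinner_smul_left, pinner_smul_right, GE] at B
  have hφp := hφ p hp
  have K : ε 2 * ε 0 * ε 1 * (l₁ p * l₂ p) = -ε 0 * (n₁ p * (l₂ p - l₁ p) + m₁ p ^ 2)
      + ε 1 * (n₂ p * (l₂ p - l₁ p) - m₂ p ^ 2) := by
    have K₀ : ε 2 * (l₁ p * (l₂ p - l₁ p)⁻¹ * ε 0) * (l₂ p * (l₂ p - l₁ p)⁻¹ * ε 1) =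
        -ε 0 * (n₁ p * (l₂ p - l₁ p)⁻¹ + m₁ p * (m₁ p / (l₂ p - l₁ p) ^ 2)) +
        ε 1 * (n₂ p * (l₂ p - l₁ p)⁻¹ - m₂ p * (m₂ p / (l₂ p - l₁ p) ^ 2)) := by
      linear_combination A - B
    field_simp at K₀
    linear_combination K₀
  linear_combination -(ε 2 * ε 0 * ε 1) * K + (ε 2 * ε 1 * ((l₂ p - l₁ p) * n₁ p + m₁ p ^ 2)) * hε 0 +
    (ε 2 * ε 0 * (m₂ p ^ 2 - (l₂ p - l₁ p) * n₂ p)) * hε 1 +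
    l₁ p * l₂ p * (ε 0 ^ 2 * ε 1 ^ 2 * hε 2 + ε 1 ^ 2 * hε 0 + hε 1)

/-- The constants `b` and `C` come from the Gauss equation: the function
`(η₁ l₂'' + η₂ l₁'' + l₁) / (l₂ - l₁)` has zero derivatives, by the derivatives of the Gauss equation,
and so does then `η₁ l₂'' - b l₂`. This holds without assuming that `l₁'` or `l₂'` does not vanish. -/
theorem IsIsothermicDupin.exists_isDupinSolution (hε : ∀ i, ε i ^ 2 = 1) (hU : IsOpen U)
    (hUc : IsConnected U) (H : IsIsothermicDupin ε U X N l₁ l₂) :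
    ∃ b C m₁ m₂, IsDupinSolution (ε 2 * ε 0) (ε 2 * ε 1) b C U l₁ l₂ m₁ m₂ := by
  obtain ⟨cl₁, cl₂⟩ := H.contDiffOn (fun i hi => by simpa [hi] using hε i) hU
  obtain ⟨m₁, cm₁, P₁, Q₁⟩ := exists_partial_snd hU cl₁ H.dupin₁
  obtain ⟨n₁, cn₁, P₁', Q₁'⟩ := exists_partial_snd hU cm₁ Q₁
  obtain ⟨o₁, -, P₁'', -⟩ := exists_partial_snd hU cn₁ Q₁'
  obtain ⟨m₂, cm₂, P₂, Q₂⟩ := exists_partial_fst hU cl₂ H.dupin₂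
  obtain ⟨n₂, cn₂, P₂', Q₂'⟩ := exists_partial_fst hU cm₂ Q₂
  obtain ⟨o₂, -, P₂'', -⟩ := exists_partial_fst hU cn₂ Q₂'
  have hG := H.gauss hε hU P₁ P₁' P₂ P₂'
  have hη₁ : (ε 2 * ε 0) ^ 2 = 1 := by rw [mul_pow, hε, hε, one_mul]
  have hη₂ : (ε 2 * ε 1) ^ 2 = 1 := by rw [mul_pow, hε, hε, one_mul]
  generalize ε 2 * ε 0 = η₁ at *
  generalize ε 2 * ε 1 = η₂ at *
  have hφ : ∀ p ∈ U, l₂ p - l₁ p ≠ 0 := fun p hp => sub_ne_zero.2 (H.distinct p hp).symm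
  have PG := (((((P₂.sub P₁).mul ((P₂''.const_mul η₁).sub (P₁''.const_mul η₂))).sub
    ((P₂'.mul P₂').const_mul η₁)).sub ((P₁'.mul P₁').const_mul η₂)).sub (P₁.mul P₂)).unique hU
    (.const 0) fun p hp => by rw [← hG p hp]; ring
  have PS := ((P₂''.const_mul η₁).add (P₁''.const_mul η₂)).add P₁
  obtain ⟨b, hb⟩ := ((PS.mul ((P₂.sub P₁).inv hφ)).congr (g' := fun _ => 0) (h' := fun _ => 0)
    (fun p hp => by
      have := hφ p hp
      have e := (PG p hp).1
      field_simp
      linear_combination e)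
    (fun p hp => by
      have := hφ p hp
      have e := (PG p hp).2
      field_simp
      linear_combination -e)).exists_eq_const hU hUc
  have hS : ∀ p ∈ U, η₁ * n₂ p + η₂ * n₁ p + l₁ p = b * (l₂ p - l₁ p) := fun p hp => by
    rw [← hb p hp, inv_mul_cancel_right₀ (hφ p hp)]
  have PS' := PS.unique hU ((P₂.sub P₁).const_mul b) fun p hp => (hS p hp).symm
  obtain ⟨C, hC⟩ := (((P₂''.const_mul η₁).sub (P₂.const_mul b)).congr (g' := fun _ => 0)
    (h' := fun _ => 0) (fun p hp => by linear_combination (PS' p hp).1)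
    (fun p _ => by ring)).exists_eq_const hU hUc
  refine ⟨b, C, m₁, m₂, P₂, P₂'.congr (fun p hp => ?_) (fun _ _ => rfl), P₁,
    P₁'.congr (fun _ _ => rfl) (fun p hp => ?_), fun p hp => ?_⟩
  · linear_combination η₁ * hC p hp - n₂ p * hη₁
  · linear_combination η₂ * hS p hp - η₂ * hC p hp - n₁ p * hη₂
  · linear_combination hG p hp + (l₂ p - l₁ p) * (hS p hp - 2 * hC p hp)

end Gauss

theorem theorem3 (ε : Fin 3 → ℝ) (hε : ∀ i, ε i ^ 2 = 1) (U : Set (ℝ × ℝ)) (hUo : IsOpen U)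
    (hUc : IsConnected U) (lam₁ lam₂ : ℝ × ℝ → ℝ) :
    (∀ X N : ℝ × ℝ → E3, IsIsothermicDupin ε U X N lam₁ lam₂ →
      ConstantCase U lam₁ lam₂ ∨ ExplicitForm (ε 2 * ε 0) (ε 2 * ε 1) U lam₁ lam₂) ∧
    ((∀ p ∈ U, lam₁ p ≠ lam₂ p) →
      (ConstantCase U lam₁ lam₂ ∨ ExplicitForm (ε 2 * ε 0) (ε 2 * ε 1) U lam₁ lam₂) →
      ∃ X N : ℝ × ℝ → E3, IsIsothermicDupin ε U X N lam₁ lam₂) := by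
  have hη₁ : (ε 2 * ε 0) ^ 2 = 1 := by rw [mul_pow, hε, hε, one_mul]
  have hη₂ : (ε 2 * ε 1) ^ 2 = 1 := by rw [mul_pow, hε, hε, one_mul]
  refine ⟨fun X N H => ?_, fun hne h => ?_⟩
  · obtain ⟨b, C, m₁, m₂, S⟩ := H.exists_isDupinSolution hε hUo hUc
    -- Pairs of constants occur among the explicit forms as well.
    exact Or.inr (S.explicitForm hη₁ hη₂ hUo hUc)
  · obtain ⟨b, C, m₁, m₂, S⟩ := exists_isDupinSolution hη₁ hη₂ hUo h
    exact S.exists_isIsothermicDupin hε hUo hUc hne
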